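/- Let $W=\{W(u);\,u\in\mathbb{R}_+^d\}$ be a $d$-parameter Wiener process on a probability space, i.e. a centered real Gaussian process with $\mathbb{E}[W(s)W(t)]=\prod_{i=1}^d \min(s_i,t_i)$. Let $H=(H_1,\dots,H_d):\mathbb{R}_+^d\to(0,1)^d$ satisfy: - for every $i$ there are constants $\alpha_i,\beta_i$ with $0<\alpha_i\le H_i(t)\le\beta_i<1$ for all $t\in\mathbb{R}_+^d$; - $H$ is $\gamma$-Hölder continuous for some $\gamma>0$: there is a constant $K$ with $\|H(t)-H(s)\|\le K\|t-s\|^{\gamma}$ for all $s,t\in\mathbb{R}_+^d$, where $\|\cdot\|$ is the Euclidean norm. Then for every $t\in\mathbb{R}_+^d$ the Wiener integral $$X(t)=\int_{\mathbb{R}_+^d}\prod_{i=1}^d (t_i-u_i)_+^{H_i(t)-\frac12}\,W(du)$$ is well defined (the $L^2$-limit of the integrals of step functions converging in $L^2(\mathbb{R}_+^d)$ to the integrand, where $\int 1_{[0,v]}(u)\,W(du)=W(v)$, and where $x_+^a=x^a$ for $x>0$ and $x_+^a=0$ for $x\le 0$), and the Riemann–Liouville multifractional Brownian sheet $X$ has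 a continuous modification on $[0,1]^d$: there are random variables $Y(t)$, $t\in[0,1]^d$, such that $t\mapsto Y(t,\omega)$ is continuous on $[0,1]^d$ for every $\omega$, and $\mathbb{P}(Y(t)=X(t))=1$ for every $t\in[0,1]^d$. -/

import Mathlib

open MeasureTheory ProbabilityTheory Filter Topology
open scoped NNReal ENNReal

namespace RLSheet

noncomputable section

/-- `W = {W(u); u ∈ ℝ₊^d}` is a `d`-parameter Wiener process (Brownian sheet) under `P`: a centered
Gaussian process with covariance `E[W(s) W(t)] = ∏ᵢ min(sᵢ, tᵢ)`. No regularity of the paths of `W`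
is required, so versions of `W` with continuous paths are included. -/
structure IsWienerProcess {Ω : Type*} [MeasurableSpace Ω] {d : ℕ}
    (W : (Fin d → ℝ≥0) → Ω → ℝ) (P : Measure Ω) : Prop where
  isGaussianProcess : IsGaussianProcess W P
  centered : ∀ t, ∫ ω, W t ω ∂P = 0
  covariance : ∀ s t, cov[W s, W t; P] = ∏ i, (min (s i) (t i) : ℝ)

/-- Lebesgue measure on `ℝ₊^d`: the product of `d` copies of Lebesgue measure on `ℝ₊`. -/
def lebesgue (d : ℕ) : Measure (Fin d → ℝ≥0) :=
  Measure.pi fun _ => (volume : Measure ℝ).comap ((↑) : ℝ≥0 → ℝ)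

/-- The step function `∑ⱼ aⱼ 1_{[0, vⱼ]}` on `ℝ₊^d`, where the finitely supported `c` sends
`vⱼ` to `aⱼ`. (`Set.Iic v` is the box `[0, v]` in `ℝ₊^d`.) -/
def stepFun {d : ℕ} (c : (Fin d → ℝ≥0) →₀ ℝ) (u : Fin d → ℝ≥0) : ℝ :=
  c.sum fun v a => a * (Set.Iic v).indicator 1 u

/-- The integral `∑ⱼ aⱼ W(vⱼ)` of the step function `∑ⱼ aⱼ 1_{[0, vⱼ]}` against `W(du)`. -/
def stepIntegral {Ω : Type*} {d : ℕ} (W : (Fin d → ℝ≥0) → Ω → ℝ)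
    (c : (Fin d → ℝ≥0) →₀ ℝ) (ω : Ω) : ℝ :=
  c.sum fun v a => a * W v ω

/-- `ξ` is (a version of) the Wiener integral `∫_{ℝ₊^d} f(u) W(du)`: `f` is square integrable for
Lebesgue measure on `ℝ₊^d`, and `ξ` is the limit in `L²(P)` of the integrals of step functions
that converge to `f` in `L²(ℝ₊^d)`. -/
def IsWienerIntegral {Ω : Type*} [MeasurableSpace Ω] {d : ℕ} (W : (Fin d → ℝ≥0) → Ω → ℝ)
    (P : Measure Ω) (f : (Fin d → ℝ≥0) → ℝ) (ξ : Ω → ℝ) : Prop :=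
  MemLp f 2 (lebesgue d) ∧ MemLp ξ 2 P ∧
    ∃ c : ℕ → ((Fin d → ℝ≥0) →₀ ℝ),
      Tendsto (fun n => eLpNorm (fun u => stepFun (c n) u - f u) 2 (lebesgue d)) atTop (𝓝 0) ∧
      Tendsto (fun n => eLpNorm (fun ω => stepIntegral W (c n) ω - ξ ω) 2 P) atTop (𝓝 0)

open Classical in
/-- The Wiener integral `∫_{ℝ₊^d} f(u) W(du)` as a random variable. When `W` is a Wiener process
it is determined up to almost sure equality, and one version is chosen (`0` if there is none). -/
def wienerIntegral {Ω : Type*} [MeasurableSpace Ω] {d : ℕ} (W : (Fin d → ℝ≥0) → Ω → ℝ)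
    (P : Measure Ω) (f : (Fin d → ℝ≥0) → ℝ) : Ω → ℝ :=
  if h : ∃ ξ, IsWienerIntegral W P f ξ then h.choose else 0

/-- The truncated power `x₊ ^ a`, equal to `x ^ a` for `x > 0` and to `0` for `x ≤ 0`
(also for `a = 0`). -/
def truncPow (x a : ℝ) : ℝ := if 0 < x then x ^ a else 0

/-- The Riemann-Liouville kernel `u ↦ ∏ᵢ (tᵢ - uᵢ)₊ ^ (Hᵢ(t) - 1/2)`. -/
def kernel {d : ℕ} (H : (Fin d → ℝ≥0) → Fin d → ℝ) (t u : Fin d → ℝ≥0) : ℝ :=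
  ∏ i, truncPow ((t i : ℝ) - (u i : ℝ)) (H t i - 1 / 2)

/-- The RL-multifractional Brownian sheet
`X(t) = ∫_{ℝ₊^d} ∏ᵢ (tᵢ - uᵢ)₊ ^ (Hᵢ(t) - 1/2) W(du)`, `t ∈ ℝ₊^d`. -/
def sheet {Ω : Type*} [MeasurableSpace Ω] {d : ℕ} (W : (Fin d → ℝ≥0) → Ω → ℝ) (P : Measure Ω)
    (H : (Fin d → ℝ≥0) → Fin d → ℝ) (t : Fin d → ℝ≥0) : Ω → ℝ :=
  wienerIntegral W P (kernel H t)

/-- The Euclidean norm on `ℝ^d`. -/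
def euclNorm {d : ℕ} (x : Fin d → ℝ) : ℝ := ‖(WithLp.toLp 2 x : EuclideanSpace ℝ (Fin d))‖

end

end RLSheet

/-! The covariance of `W` says that `W(s)` and `W(t)` have the same inner product in `L²(P)` as the
indicators of `[0, s]` and `[0, t]` in `L²(ℝ₊^d)`. Hence integration of step functions is an
isometry, and since step functions are dense (`denseRange_stepLp`), every square integrable function
has a Wiener integral. The kernel is square integrable because `2 Hᵢ(t) - 1 > -1`.

An increment `X(s) - X(t)` is an `L²` limit of centered Gaussian variables, so each of its `Lᵖ`
norms is at most a constant times the `L²` distance of the two kernels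
(`IsWienerIntegral.eLpNorm_le`). Any Hölder bound on that distance, however small its exponent,
therefore feeds Kolmogorov's criterion once `p` is large.

For the Hölder bound, the one-parameter kernel is monotone in the exponent when time stays in `[0,
1]`. At a fixed exponent it is monotone in time as long as both kernels are nonzero. Where `0 ≤ B ≤
A` one has `(A - B)² ≤ A² - B²`, and the integrals of the squares are explicit
(`integral_kernelOne_sub_sq_le`). Fubini and a telescoping of products carry the bound to `d`
parameters (`integral_prod_sub_prod_sq_le`).

Kolmogorov's criterion is proved by chaining along nets (`exists_continuous_modification`) and
applied to the dyadic grids of the cube. -/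

namespace RLSheet

/-! ### Lebesgue measure on the orthant -/

/-- Lebesgue measure on `ℝ₊`. -/
noncomputable def halfLine : Measure ℝ≥0 := (volume : Measure ℝ).comap ((↑) : ℝ≥0 → ℝ)

theorem measurableEmbedding_coe : MeasurableEmbedding ((↑) : ℝ≥0 → ℝ) :=
  MeasurableEmbedding.subtype_coe measurableSet_Ici

theorem halfLine_Iic (x : ℝ≥0) : halfLine (Set.Iic x) = ENNReal.ofReal x := by
  rw [halfLine, measurableEmbedding_coe.comap_apply]
  have : ((↑) : ℝ≥0 → ℝ) '' Set.Iic x = Set.Icc 0 (x : ℝ) := by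
    ext y
    simp only [Set.mem_image, Set.mem_Iic, Set.mem_Icc]
    constructor
    · rintro ⟨z, hz, rfl⟩
      exact ⟨z.2, by exact_mod_cast hz⟩
    · rintro ⟨h0, h1⟩
      exact ⟨⟨y, h0⟩, by exact_mod_cast h1, rfl⟩
  rw [this, Real.volume_Icc, sub_zero]

theorem iUnion_Iic_natCast : ⋃ n : ℕ, Set.Iic ((n : ℕ) : ℝ≥0) = Set.univ := by
  refine Set.eq_univ_of_forall fun x => Set.mem_iUnion.2 ?_
  obtain ⟨n, hn⟩ := exists_nat_ge x
  exact ⟨n, hn⟩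

instance : SigmaFinite halfLine :=
  ⟨⟨⟨fun n => Set.Iic (n : ℝ≥0), fun _ => trivial, fun n => by simp [halfLine_Iic],
    iUnion_Iic_natCast⟩⟩⟩

theorem lebesgue_eq (d : ℕ) : lebesgue d = Measure.pi fun _ => halfLine := rfl

instance (d : ℕ) : SigmaFinite (lebesgue d) := by rw [lebesgue_eq]; infer_instance

theorem lebesgue_Iic {d : ℕ} (v : Fin d → ℝ≥0) :
    lebesgue d (Set.Iic v) = ∏ i, ENNReal.ofReal (v i) := by
  rw [← Set.pi_univ_Iic, lebesgue_eq, Measure.pi_pi]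
  simp_rw [halfLine_Iic]

theorem lebesgue_Iic_ne_top {d : ℕ} (v : Fin d → ℝ≥0) : lebesgue d (Set.Iic v) ≠ ∞ := by
  rw [lebesgue_Iic]
  exact ENNReal.prod_ne_top fun _ _ => ENNReal.ofReal_ne_top

theorem lebesgue_real_Iic_inter {d : ℕ} (s t : Fin d → ℝ≥0) :
    (lebesgue d).real (Set.Iic s ∩ Set.Iic t) = ∏ i, (min (s i) (t i) : ℝ) := by
  rw [Set.Iic_inter_Iic, measureReal_def, lebesgue_Iic, ENNReal.toReal_prod]
  refine Finset.prod_congr rfl fun i _ => ?_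
  rw [ENNReal.toReal_ofReal (NNReal.coe_nonneg _)]
  simp

theorem measurableSpace_pi_eq_generateFrom_Iic (d : ℕ) :
    (MeasurableSpace.pi : MeasurableSpace (Fin d → ℝ≥0)) =
      MeasurableSpace.generateFrom (Set.range Set.Iic) := by
  have h := @generateFrom_pi_eq (Fin d) (fun _ => ℝ≥0) _ (fun _ => Set.range Set.Iic)
    (fun _ => ⟨fun n : ℕ => Set.Iic (n : ℝ≥0), fun n => ⟨_, rfl⟩, iUnion_Iic_natCast⟩)
  have h1 : (inferInstance : MeasurableSpace ℝ≥0) =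
      MeasurableSpace.generateFrom (Set.range Set.Iic) := by
    rw [← borel_eq_generateFrom_Iic]
    exact BorelSpace.measurable_eq
  rw [← h1] at h
  rw [h]
  congr 1
  ext A
  simp only [Set.mem_image, Set.mem_univ_pi, Set.mem_range]
  constructor
  · rintro ⟨s, hs, rfl⟩
    choose v hv using hs
    refine ⟨v, ?_⟩
    rw [← Set.pi_univ_Iic]
    simp_rw [hv]
  · rintro ⟨v, rfl⟩
    exact ⟨fun i => Set.Iic (v i), fun i => ⟨_, rfl⟩, Set.pi_univ_Iic v⟩

/-- A square integrable function on the orthant whose integral over every box `[0, v]` vanishes is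
zero almost everywhere. -/
theorem ae_eq_zero_of_forall_setIntegral_Iic {d : ℕ} {g : (Fin d → ℝ≥0) → ℝ}
    (hg : MemLp g 2 (lebesgue d)) (h : ∀ v, ∫ u in Set.Iic v, g u ∂lebesgue d = 0) :
    g =ᵐ[lebesgue d] 0 := by
  -- On a bounded box the measure is finite, so `g` is integrable there and a π-λ argument over the
  -- sub-boxes applies.
  have key : ∀ n : ℕ, ∀ᵐ u ∂(lebesgue d).restrict (Set.Iic fun _ => (n : ℝ≥0)), g u = 0 := by
    intro n
    set N : Fin d → ℝ≥0 := fun _ => n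
    have : IsFiniteMeasure ((lebesgue d).restrict (Set.Iic N)) :=
      ⟨by simpa using (lebesgue_Iic_ne_top N).lt_top⟩
    have hint : Integrable g ((lebesgue d).restrict (Set.Iic N)) :=
      (hg.restrict _).integrable (by norm_num)
    refine hint.ae_eq_zero_of_forall_setIntegral_eq_zero fun s hs _ => ?_
    induction s, hs using MeasurableSpace.induction_on_inter
      (measurableSpace_pi_eq_generateFrom_Iic d) with
    | h_inter =>
      rintro _ ⟨v, rfl⟩ _ ⟨w, rfl⟩ _
      exact ⟨v ⊓ w, Set.Iic_inter_Iic.symm⟩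
    | empty => simp
    | basic t ht =>
      obtain ⟨v, rfl⟩ := ht
      rw [Measure.restrict_restrict measurableSet_Iic, Set.Iic_inter_Iic]
      exact h _
    | compl t htm ih =>
      have := integral_add_compl htm hint
      rw [ih (measure_lt_top _ _), zero_add, h] at this
      exact this
    | iUnion f hd hm ih =>
      rw [integral_iUnion hm hd hint.integrableOn]
      simp [ih _ (measure_lt_top _ _)]
  have hU : ⋃ n : ℕ, Set.Iic (fun _ : Fin d => (n : ℝ≥0)) = Set.univ := by
    refine Set.eq_univ_of_forall fun x => Set.mem_iUnion.2 ?_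
    obtain ⟨n, hn⟩ := exists_nat_ge (Finset.univ.sup x)
    exact ⟨n, fun i => (Finset.le_sup (Finset.mem_univ i)).trans hn⟩
  have := ae_restrict_iUnion_iff (μ := lebesgue d)
    (fun n : ℕ => Set.Iic (fun _ : Fin d => (n : ℝ≥0))) (fun u => g u = 0)
  rw [hU, Measure.restrict_univ] at this
  exact this.2 key

/-! ### Wiener integrals -/

section WienerIntegral

theorem stepIntegral_sub {Ω : Type*} {d : ℕ} {W : (Fin d → ℝ≥0) → Ω → ℝ}
    (c c' : (Fin d → ℝ≥0) →₀ ℝ) (ω : Ω) :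
    stepIntegral W (c - c') ω = stepIntegral W c ω - stepIntegral W c' ω :=
  Finsupp.sum_sub_index (by intros; ring)

variable {Ω : Type*} [MeasurableSpace Ω] {P : Measure Ω} {d : ℕ} {W : (Fin d → ℝ≥0) → Ω → ℝ}

/-- The indicator of the box `[0, v]` as an element of `L²`. -/
noncomputable def boxLp {d : ℕ} (v : Fin d → ℝ≥0) : Lp ℝ 2 (lebesgue d) :=
  indicatorConstLp 2 measurableSet_Iic (lebesgue_Iic_ne_top v) 1

/-- Step functions as elements of `L²`. -/
noncomputable def stepLp (d : ℕ) : ((Fin d → ℝ≥0) →₀ ℝ) →ₗ[ℝ] Lp ℝ 2 (lebesgue d) :=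
  Finsupp.linearCombination ℝ boxLp

theorem stepLp_ae_eq {d : ℕ} (c : (Fin d → ℝ≥0) →₀ ℝ) : stepLp d c =ᵐ[lebesgue d] stepFun c := by
  induction c using Finsupp.induction_linear with
  | zero =>
    rw [map_zero]
    filter_upwards [Lp.coeFn_zero ℝ 2 (lebesgue d)] with u hu
    rw [hu, stepFun, Finsupp.sum_zero_index, Pi.zero_apply]
  | add f g hf hg =>
    rw [map_add]
    filter_upwards [Lp.coeFn_add (stepLp d f) (stepLp d g), hf, hg] with u h h1 h2
    rw [h, Pi.add_apply, h1, h2, stepFun, stepFun, stepFun,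
      Finsupp.sum_add_index' (by simp) (by intros; ring)]
  | single v a =>
    rw [stepLp, Finsupp.linearCombination_single]
    filter_upwards [Lp.coeFn_smul a (boxLp v), indicatorConstLp_coeFn (p := 2) (c := (1 : ℝ))
      (hs := measurableSet_Iic) (hμs := lebesgue_Iic_ne_top v)] with u h h1
    rw [h, Pi.smul_apply, boxLp, h1, stepFun, Finsupp.sum_single_index (by simp)]
    rfl

/-- A function orthogonal to all step functions has zero integral over every box, hence vanishes; so
the closed span of the box indicators is everything. -/
theorem denseRange_stepLp (d : ℕ) : DenseRange (stepLp d) := by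
  have h : (LinearMap.range (stepLp d)).topologicalClosure = ⊤ := by
    rw [Submodule.topologicalClosure_eq_top_iff, Submodule.eq_bot_iff]
    intro g hg
    rw [Lp.eq_zero_iff_ae_eq_zero]
    refine ae_eq_zero_of_forall_setIntegral_Iic (Lp.memLp g) fun v => ?_
    have := (Submodule.mem_orthogonal _ _).1 hg (boxLp v)
      ⟨Finsupp.single v 1, by simp [stepLp]⟩
    rwa [boxLp, L2.inner_indicatorConstLp_one] at this
  have h' := congrArg (SetLike.coe) h
  rw [Submodule.topologicalClosure_coe] at h'
  exact dense_iff_closure_eq.2 h'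

theorem memLp_stepFun {d : ℕ} (c : (Fin d → ℝ≥0) →₀ ℝ) : MemLp (stepFun c) 2 (lebesgue d) :=
  (memLp_congr_ae (stepLp_ae_eq c)).1 (Lp.memLp _)

theorem stepFun_sub {d : ℕ} (c c' : (Fin d → ℝ≥0) →₀ ℝ) (u : Fin d → ℝ≥0) :
    stepFun (c - c') u = stepFun c u - stepFun c' u :=
  Finsupp.sum_sub_index (by intros; ring)

theorem inner_boxLp (s t : Fin d → ℝ≥0) :
    inner ℝ (boxLp s) (boxLp t) = ∏ i, (min (s i) (t i) : ℝ) := by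
  rw [boxLp, L2.inner_indicatorConstLp_one, boxLp,
    setIntegral_indicatorConstLp measurableSet_Iic, smul_eq_mul, mul_one, Set.inter_comm,
    lebesgue_real_Iic_inter]

namespace IsWienerProcess

theorem memLp (hW : IsWienerProcess W P) (v : Fin d → ℝ≥0) : MemLp (W v) 2 P :=
  (hW.isGaussianProcess.hasGaussianLaw_eval v).memLp_two

/-- The integrals of step functions as elements of `L²(P)`. -/
noncomputable def integralLp (hW : IsWienerProcess W P) :
    ((Fin d → ℝ≥0) →₀ ℝ) →ₗ[ℝ] Lp ℝ 2 P :=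
  Finsupp.linearCombination ℝ fun v => (hW.memLp v).toLp (W v)

theorem integralLp_ae_eq (hW : IsWienerProcess W P) (c : (Fin d → ℝ≥0) →₀ ℝ) :
    hW.integralLp c =ᵐ[P] stepIntegral W c := by
  induction c using Finsupp.induction_linear with
  | zero =>
    rw [map_zero]
    filter_upwards [Lp.coeFn_zero ℝ 2 P] with u hu
    rw [hu, stepIntegral, Finsupp.sum_zero_index, Pi.zero_apply]
  | add f g hf hg =>
    rw [map_add]
    filter_upwards [Lp.coeFn_add (hW.integralLp f) (hW.integralLp g), hf, hg] with u h h1 h2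
    rw [h, Pi.add_apply, h1, h2, stepIntegral, stepIntegral, stepIntegral,
      Finsupp.sum_add_index' (by simp) (by intros; ring)]
  | single v a =>
    rw [integralLp, Finsupp.linearCombination_single]
    filter_upwards [Lp.coeFn_smul a ((hW.memLp v).toLp (W v)), (hW.memLp v).coeFn_toLp]
      with u h h1
    rw [h, Pi.smul_apply, h1, stepIntegral, Finsupp.sum_single_index (by simp)]
    rfl

theorem memLp_stepIntegral (hW : IsWienerProcess W P) (c : (Fin d → ℝ≥0) →₀ ℝ) :
    MemLp (stepIntegral W c) 2 P :=
  (memLp_congr_ae (hW.integralLp_ae_eq c)).1 (Lp.memLp _)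

theorem hasGaussianLaw_stepIntegral (hW : IsWienerProcess W P) (c : (Fin d → ℝ≥0) →₀ ℝ) :
    HasGaussianLaw (stepIntegral W c) P := by
  have h := (hW.isGaussianProcess.smul (c : (Fin d → ℝ≥0) → ℝ)).hasGaussianLaw_fun_sum
    (I := c.support)
  exact h

variable [IsProbabilityMeasure P]

theorem inner_toLp (hW : IsWienerProcess W P) (s t : Fin d → ℝ≥0) :
    inner ℝ ((hW.memLp s).toLp (W s)) ((hW.memLp t).toLp (W t)) =
      inner ℝ (boxLp s) (boxLp t) := by
  rw [inner_boxLp, ← hW.covariance, covariance_eq_sub (hW.memLp s) (hW.memLp t), hW.centered,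
    zero_mul, sub_zero, L2.inner_def]
  refine integral_congr_ae ?_
  filter_upwards [(hW.memLp s).coeFn_toLp, (hW.memLp t).coeFn_toLp] with ω h1 h2
  rw [h1, h2]
  simp [mul_comm]

/-- Both sides expand by bilinearity into the same double sum, by `inner_toLp`. -/
theorem norm_integralLp (hW : IsWienerProcess W P) (c : (Fin d → ℝ≥0) →₀ ℝ) :
    ‖hW.integralLp c‖ = ‖stepLp d c‖ := by
  have h : inner ℝ (hW.integralLp c) (hW.integralLp c) = inner ℝ (stepLp d c) (stepLp d c) := by
    simp only [integralLp, stepLp, Finsupp.linearCombination_apply, Finsupp.sum, sum_inner,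
      inner_sum, real_inner_smul_left, real_inner_smul_right, hW.inner_toLp]
  rw [real_inner_self_eq_norm_sq, real_inner_self_eq_norm_sq] at h
  exact (sq_eq_sq₀ (norm_nonneg _) (norm_nonneg _)).1 h

theorem eLpNorm_stepIntegral_two (hW : IsWienerProcess W P) (c : (Fin d → ℝ≥0) →₀ ℝ) :
    eLpNorm (stepIntegral W c) 2 P = eLpNorm (stepFun c) 2 (lebesgue d) := by
  rw [← eLpNorm_congr_ae (hW.integralLp_ae_eq c), ← eLpNorm_congr_ae (stepLp_ae_eq c),
    ← Lp.enorm_def, ← Lp.enorm_def, ← ofReal_norm, ← ofReal_norm, hW.norm_integralLp]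

/-- Every square integrable function has a Wiener integral. -/
theorem exists_isWienerIntegral (hW : IsWienerProcess W P) {f : (Fin d → ℝ≥0) → ℝ}
    (hf : MemLp f 2 (lebesgue d)) : ∃ ξ, IsWienerIntegral W P f ξ := by
  have hmem : hf.toLp f ∈ closure (Set.range (stepLp d)) := denseRange_stepLp d _
  obtain ⟨x, hx, hlim⟩ := mem_closure_iff_seq_limit.1 hmem
  choose c hc using hx
  have hcau : CauchySeq fun n => hW.integralLp (c n) := by
    rw [Metric.cauchySeq_iff']
    intro ε hε
    obtain ⟨N, hN⟩ := Metric.cauchySeq_iff'.1 hlim.cauchySeq ε hε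
    refine ⟨N, fun n hn => ?_⟩
    have := hN n hn
    rwa [dist_eq_norm, ← hc, ← hc, ← map_sub, ← hW.norm_integralLp, map_sub,
      ← dist_eq_norm] at this
  obtain ⟨ξ, hξ⟩ := cauchySeq_tendsto_of_complete hcau
  refine ⟨ξ, hf, Lp.memLp ξ, c, ?_, ?_⟩
  · rw [Lp.tendsto_Lp_iff_tendsto_eLpNorm'] at hlim
    refine hlim.congr fun n => eLpNorm_congr_ae ?_
    rw [← hc]
    filter_upwards [stepLp_ae_eq (c n), hf.coeFn_toLp] with u h1 h2
    rw [Pi.sub_apply, h1, h2]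
  · rw [Lp.tendsto_Lp_iff_tendsto_eLpNorm'] at hξ
    refine hξ.congr fun n => eLpNorm_congr_ae ?_
    filter_upwards [hW.integralLp_ae_eq (c n)] with u h1
    rw [Pi.sub_apply, h1]

theorem isWienerIntegral_wienerIntegral (hW : IsWienerProcess W P) {f : (Fin d → ℝ≥0) → ℝ}
    (hf : MemLp f 2 (lebesgue d)) : IsWienerIntegral W P f (wienerIntegral W P f) := by
  have h := hW.exists_isWienerIntegral hf
  rw [wienerIntegral, dif_pos h]
  exact h.choose_spec

theorem integral_stepIntegral (hW : IsWienerProcess W P) (c : (Fin d → ℝ≥0) →₀ ℝ) :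
    ∫ ω, stepIntegral W c ω ∂P = 0 := by
  simp only [stepIntegral, Finsupp.sum]
  rw [integral_finsetSum _ fun v _ => ((hW.memLp v).integrable (by norm_num)).const_mul _]
  refine Finset.sum_eq_zero fun v _ => ?_
  rw [integral_const_mul, hW.centered, mul_zero]

/-- The `Lᵖ` norm of the integral of a step function is a constant multiple of its `L²` norm. -/
theorem eLpNorm_stepIntegral (hW : IsWienerProcess W P) (c : (Fin d → ℝ≥0) →₀ ℝ) (p : ℝ≥0∞) :
    eLpNorm (stepIntegral W c) p P =
      eLpNorm id p (gaussianReal 0 1) * eLpNorm (stepFun c) 2 (lebesgue d) := by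
  set σ : ℝ := ‖hW.integralLp c‖
  have hσ : ENNReal.ofReal σ = eLpNorm (stepFun c) 2 (lebesgue d) := by
    rw [← hW.eLpNorm_stepIntegral_two, ← eLpNorm_congr_ae (hW.integralLp_ae_eq c),
      ← Lp.enorm_def, ofReal_norm]
  have hvar : Var[stepIntegral W c; P] = σ ^ 2 := by
    rw [variance_of_integral_eq_zero (hW.memLp_stepIntegral c).aemeasurable
      (hW.integral_stepIntegral c), ← real_inner_self_eq_norm_sq, L2.inner_def]
    refine integral_congr_ae ?_
    filter_upwards [hW.integralLp_ae_eq c] with ω h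
    rw [h]
    simp [sq]
  have hmap := (hW.hasGaussianLaw_stepIntegral c).map_eq_gaussianReal
  rw [hW.integral_stepIntegral, hvar] at hmap
  have hscale := gaussianReal_map_const_mul (μ := 0) (v := 1) σ
  rw [mul_zero, mul_one] at hscale
  have hv : (σ ^ 2).toNNReal = NNReal.mk (σ ^ 2) (sq_nonneg σ) :=
    Real.toNNReal_of_nonneg (sq_nonneg σ)
  -- The law of the step integral is that of `σ Z` with `Z` standard normal.
  rw [hv, ← hscale] at hmap
  calc eLpNorm (stepIntegral W c) p P
      = eLpNorm id p (P.map (stepIntegral W c)) := by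
        rw [eLpNorm_map_measure aestronglyMeasurable_id (hW.memLp_stepIntegral c).aemeasurable]
        rfl
    _ = eLpNorm (fun x => σ * x) p (gaussianReal 0 1) := by
        rw [hmap, eLpNorm_map_measure aestronglyMeasurable_id (by fun_prop)]
        rfl
    _ = eLpNorm (σ • (id : ℝ → ℝ)) p (gaussianReal 0 1) := rfl
    _ = _ := by
        rw [eLpNorm_const_smul, ← hσ, mul_comm, ← ofReal_norm, Real.norm_of_nonneg (norm_nonneg _)]

end IsWienerProcess

namespace IsWienerIntegral

/-- Subtract the approximating step functions. Stating this for the relation `IsWienerIntegral`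
makes it apply to whichever versions `wienerIntegral` has chosen. -/
theorem sub (hW : IsWienerProcess W P) {f g : (Fin d → ℝ≥0) → ℝ} {ξ η : Ω → ℝ}
    (hf : IsWienerIntegral W P f ξ) (hg : IsWienerIntegral W P g η) :
    IsWienerIntegral W P (f - g) (ξ - η) := by
  obtain ⟨hf2, hξ, c, hc, hcξ⟩ := hf
  obtain ⟨hg2, hη, c', hc', hcη⟩ := hg
  refine ⟨hf2.sub hg2, hξ.sub hη, fun n => c n - c' n, ?_, ?_⟩
  · have h0 := hc.add hc'
    rw [add_zero] at h0
    refine tendsto_of_tendsto_of_tendsto_of_le_of_le tendsto_const_nhds h0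
      (fun _ => zero_le) fun n => ?_
    have e : (fun u => stepFun (c n - c' n) u - (f - g) u) =
        (stepFun (c n) - f) - (stepFun (c' n) - g) := by
      funext u
      simp only [stepFun_sub, Pi.sub_apply]
      ring
    rw [e]
    exact eLpNorm_sub_le ((memLp_stepFun _).sub hf2).1 ((memLp_stepFun _).sub hg2).1 (by norm_num)
  · have h0 := hcξ.add hcη
    rw [add_zero] at h0
    refine tendsto_of_tendsto_of_tendsto_of_le_of_le tendsto_const_nhds h0
      (fun _ => zero_le) fun n => ?_
    have e : (fun ω => stepIntegral W (c n - c' n) ω - (ξ - η) ω) =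
        (stepIntegral W (c n) - ξ) - (stepIntegral W (c' n) - η) := by
      funext u
      simp only [stepIntegral_sub, Pi.sub_apply]
      ring
    rw [e]
    exact eLpNorm_sub_le ((hW.memLp_stepIntegral _).sub hξ).1 ((hW.memLp_stepIntegral _).sub hη).1
      (by norm_num)

/-- The moments of a Wiener integral are controlled by the `L²` norm of the integrand. -/
theorem eLpNorm_le [IsProbabilityMeasure P] (hW : IsWienerProcess W P)
    {f : (Fin d → ℝ≥0) → ℝ} {ξ : Ω → ℝ} (hf : IsWienerIntegral W P f ξ) (p : ℝ≥0) :
    eLpNorm ξ p P ≤ eLpNorm id p (gaussianReal 0 1) * eLpNorm f 2 (lebesgue d) := by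
  obtain ⟨hf2, hξ, c, hc, hcξ⟩ := hf
  -- Convergence is only known in `L²`. An almost surely convergent subsequence and Fatou's lemma
  -- give the bound for every `p`.
  obtain ⟨ns, hns, hae⟩ := (tendstoInMeasure_of_tendsto_eLpNorm (by norm_num)
    (fun n => (hW.memLp_stepIntegral (c n)).1) hξ.1 hcξ).exists_seq_tendsto_ae
  refine (Lp.eLpNorm_lim_le_liminf_eLpNorm
    (fun n => (hW.memLp_stepIntegral (c (ns n))).1) ξ hae).trans ?_
  simp_rw [hW.eLpNorm_stepIntegral]
  have hC : eLpNorm id p (gaussianReal 0 1) ≠ ∞ := (memLp_id_gaussianReal p).eLpNorm_ne_top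
  have h0 : Tendsto (fun n => eLpNorm id p (gaussianReal 0 1) *
      (eLpNorm (fun u => stepFun (c (ns n)) u - f u) 2 (lebesgue d) +
        eLpNorm f 2 (lebesgue d))) atTop
      (𝓝 (eLpNorm id p (gaussianReal 0 1) * (0 + eLpNorm f 2 (lebesgue d)))) :=
    ENNReal.Tendsto.const_mul ((hc.comp hns.tendsto_atTop).add tendsto_const_nhds) (Or.inr hC)
  rw [zero_add] at h0
  rw [← h0.liminf_eq]
  refine liminf_le_liminf (Eventually.of_forall fun n => ?_)
  gcongr
  have e : stepFun (c (ns n)) = (fun u => stepFun (c (ns n)) u - f u) + f := by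
    funext u
    simp
  conv_lhs => rw [e]
  exact eLpNorm_add_le ((memLp_stepFun _).sub hf2).1 hf2.1 (by norm_num)

end IsWienerIntegral

end WienerIntegral

/-! ### Square integrals of the one-parameter kernel -/

theorem truncPow_nonneg (x a : ℝ) : 0 ≤ truncPow x a := by
  unfold truncPow
  split_ifs with h
  · exact Real.rpow_nonneg h.le a
  · exact le_rfl

/-- The one-parameter kernel `u ↦ (x - u)₊ ^ (h - 1/2)`. -/
noncomputable def kernelOne (x : ℝ≥0) (h : ℝ) (u : ℝ≥0) : ℝ :=
  truncPow ((x : ℝ) - (u : ℝ)) (h - 1 / 2)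

theorem kernelOne_nonneg (x : ℝ≥0) (h : ℝ) (u : ℝ≥0) : 0 ≤ kernelOne x h u :=
  truncPow_nonneg _ _

theorem kernelOne_of_lt {x u : ℝ≥0} (hu : u < x) (h : ℝ) :
    kernelOne x h u = ((x : ℝ) - u) ^ (h - 1 / 2) := by
  rw [kernelOne, truncPow, if_pos (sub_pos.2 (by exact_mod_cast hu))]

theorem kernelOne_of_le {x u : ℝ≥0} (hu : x ≤ u) (h : ℝ) : kernelOne x h u = 0 := by
  rw [kernelOne, truncPow, if_neg (not_lt.2 (sub_nonpos.2 (by exact_mod_cast hu)))]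

theorem measurable_kernelOne (x : ℝ≥0) (h : ℝ) : Measurable (kernelOne x h) := by
  unfold kernelOne truncPow
  refine Measurable.ite (measurableSet_lt measurable_const (by fun_prop)) ?_ measurable_const
  fun_prop

theorem kernelOne_sq_of_lt {x u : ℝ≥0} (hu : u < x) (h : ℝ) :
    kernelOne x h u ^ 2 = ((x : ℝ) - u) ^ (2 * h - 1) := by
  rw [kernelOne_of_lt hu, ← Real.rpow_natCast, ← Real.rpow_mul]
  · congr 1
    push_cast
    ring
  · exact sub_nonneg.2 (by exact_mod_cast hu.le)

/-- The case `x = 0` gives the full square norm; general `x` gives the mass the kernel gains on `[x,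
y]` when time moves from `x` to `y`. -/
theorem integral_kernelOne_sq_Ici {x y : ℝ≥0} (hxy : x ≤ y) {h : ℝ} (hh : 0 < h) :
    IntegrableOn (fun u => kernelOne y h u ^ 2) (Set.Ici x) halfLine ∧
      ∫ u in Set.Ici x, kernelOne y h u ^ 2 ∂halfLine = ((y : ℝ) - x) ^ (2 * h) / (2 * h) := by
  have hxy' : (x : ℝ) ≤ y := by exact_mod_cast hxy
  -- The open interval avoids `v = y`, where `0 ^ (2h - 1)` equals `1` if `h = 1/2` whereas the
  -- truncated power is `0`.
  set F : ℝ → ℝ := (Set.Ioo (x : ℝ) y).indicator fun v => ((y : ℝ) - v) ^ (2 * h - 1)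
  have hx : halfLine {x} = 0 := by
    rw [halfLine, measurableEmbedding_coe.comap_apply, Set.image_singleton, measure_singleton]
  have hae : (Set.Ici x).indicator (fun u => kernelOne y h u ^ 2) =ᵐ[halfLine]
      fun u => F (u : ℝ) := by
    have : ∀ᵐ u ∂halfLine, u ≠ x := by
      rw [ae_iff]
      simpa using hx
    filter_upwards [this] with u hu
    by_cases h1 : x ≤ u
    · have h1' : (x : ℝ) < u := by exact_mod_cast lt_of_le_of_ne h1 (Ne.symm hu)
      rw [Set.indicator_of_mem (Set.mem_Ici.2 h1)]
      by_cases h2 : u < y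
      · rw [kernelOne_sq_of_lt h2]
        have h3 : (u : ℝ) ∈ Set.Ioo (x : ℝ) y := ⟨h1', by exact_mod_cast h2⟩
        have e : F u = ((y : ℝ) - u) ^ (2 * h - 1) := Set.indicator_of_mem h3 _
        exact e.symm
      · rw [kernelOne_of_le (not_lt.1 h2)]
        have e : F u = 0 := Set.indicator_of_notMem (fun h3 => h2 (by exact_mod_cast h3.2)) _
        rw [e]
        exact zero_pow two_ne_zero
    · rw [Set.indicator_of_notMem (by simpa using h1)]
      have e : F u = 0 := Set.indicator_of_notMem (fun h3 => h1 (by exact_mod_cast h3.1.le)) _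
      exact e.symm
  have hpow : IntervalIntegrable (fun v : ℝ => v ^ (2 * h - 1)) volume
      ((y : ℝ) - x) ((y : ℝ) - y) := intervalIntegral.intervalIntegrable_rpow' (by linarith)
  have hii : IntervalIntegrable (fun v : ℝ => ((y : ℝ) - v) ^ (2 * h - 1)) volume x y := by
    simpa using hpow.comp_sub_left (y : ℝ)
  have hval : ∫ v in (x : ℝ)..y, ((y : ℝ) - v) ^ (2 * h - 1) =
      ((y : ℝ) - x) ^ (2 * h) / (2 * h) := by
    rw [intervalIntegral.integral_comp_sub_left (fun v => v ^ (2 * h - 1)) (y : ℝ),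
      integral_rpow (Or.inl (by linarith)), sub_self, sub_add_cancel,
      Real.zero_rpow (by positivity), sub_zero]
  have hFint : Integrable F volume := by
    rw [integrable_indicator_iff measurableSet_Ioo]
    rw [intervalIntegrable_iff_integrableOn_Ioo_of_le hxy'] at hii
    exact hii
  have hFsupp : (Set.range ((↑) : ℝ≥0 → ℝ)).indicator F = F := by
    refine Set.indicator_eq_self.2 fun v hv => ?_
    have : v ∈ Set.Ioo (x : ℝ) y := by
      by_contra h3
      exact hv (Set.indicator_of_notMem h3 _)
    exact ⟨⟨v, x.2.trans this.1.le⟩, rfl⟩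
  have hmeasrange : MeasurableSet (Set.range ((↑) : ℝ≥0 → ℝ)) :=
    measurableEmbedding_coe.measurableSet_range
  have hmap : halfLine.map ((↑) : ℝ≥0 → ℝ) =
      volume.restrict (Set.range ((↑) : ℝ≥0 → ℝ)) := measurableEmbedding_coe.map_comap _
  constructor
  · rw [← integrable_indicator_iff measurableSet_Ici, integrable_congr hae]
    have : Integrable F (halfLine.map ((↑) : ℝ≥0 → ℝ)) := by
      rw [hmap]
      exact hFint.restrict
    exact (measurableEmbedding_coe.integrable_map_iff).1 this
  · rw [← integral_indicator measurableSet_Ici, integral_congr_ae hae,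
      ← measurableEmbedding_coe.integral_map, hmap, ← integral_indicator hmeasrange, hFsupp,
      integral_indicator measurableSet_Ioo, ← integral_Ioc_eq_integral_Ioo,
      ← intervalIntegral.integral_of_le hxy', hval]

theorem integrable_kernelOne_sq (x : ℝ≥0) {h : ℝ} (hh : 0 < h) :
    Integrable (fun u => kernelOne x h u ^ 2) halfLine := by
  have h0 := (integral_kernelOne_sq_Ici (zero_le : 0 ≤ x) hh).1
  have e : Set.Ici (0 : ℝ≥0) = Set.univ := Set.Ici_bot
  rwa [e, integrableOn_univ] at h0

theorem integral_kernelOne_sq (x : ℝ≥0) {h : ℝ} (hh : 0 < h) :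
    ∫ u, kernelOne x h u ^ 2 ∂halfLine = (x : ℝ) ^ (2 * h) / (2 * h) := by
  have h0 := (integral_kernelOne_sq_Ici (zero_le : 0 ≤ x) hh).2
  have e : Set.Ici (0 : ℝ≥0) = Set.univ := Set.Ici_bot
  rwa [e, setIntegral_univ, NNReal.coe_zero, sub_zero] at h0

theorem memLp_kernelOne (x : ℝ≥0) {h : ℝ} (hh : 0 < h) : MemLp (kernelOne x h) 2 halfLine :=
  (memLp_two_iff_integrable_sq (measurable_kernelOne x h).aestronglyMeasurable).2
    (integrable_kernelOne_sq x hh)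

theorem integrable_kernelOne_sub_sq (x y : ℝ≥0) {h k : ℝ} (hh : 0 < h) (hk : 0 < k) :
    Integrable (fun u => (kernelOne x h u - kernelOne y k u) ^ 2) halfLine :=
  ((memLp_kernelOne x hh).sub (memLp_kernelOne y hk)).integrable_sq

theorem sub_sq_le_sq_sub_sq {a b : ℝ} (hb : 0 ≤ b) (hab : b ≤ a) :
    (a - b) ^ 2 ≤ a ^ 2 - b ^ 2 := by
  nlinarith [mul_nonneg hb (sub_nonneg.2 hab)]

/-- Since `0 < x - u ≤ 1`, raising the exponent lowers the kernel, so the square of the difference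
is at most the difference of the squares. -/
theorem integral_kernelOne_sub_sq_exponent {a : ℝ} (ha : 0 < a) {x : ℝ≥0} (hx : x ≤ 1) {h k : ℝ}
    (hh : a ≤ h) (hhk : h ≤ k) :
    ∫ u, (kernelOne x h u - kernelOne x k u) ^ 2 ∂halfLine ≤ (k - h) / (2 * a ^ 2) := by
  have hh0 : 0 < h := ha.trans_le hh
  have hk0 : 0 < k := hh0.trans_le hhk
  have hx' : (x : ℝ) ≤ 1 := by exact_mod_cast hx
  calc ∫ u, (kernelOne x h u - kernelOne x k u) ^ 2 ∂halfLine
      ≤ ∫ u, (kernelOne x h u ^ 2 - kernelOne x k u ^ 2) ∂halfLine := by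
        refine integral_mono (integrable_kernelOne_sub_sq x x hh0 hk0)
          ((integrable_kernelOne_sq x hh0).sub (integrable_kernelOne_sq x hk0)) fun u => ?_
        refine sub_sq_le_sq_sub_sq (kernelOne_nonneg _ _ _) ?_
        rcases lt_or_ge u x with hu | hu
        · rw [kernelOne_of_lt hu, kernelOne_of_lt hu]
          have hu' : (u : ℝ) < x := by exact_mod_cast hu
          exact Real.rpow_le_rpow_of_exponent_ge (by linarith)
            (by linarith [u.coe_nonneg]) (by linarith)
        · rw [kernelOne_of_le hu, kernelOne_of_le hu]
    _ = (x : ℝ) ^ (2 * h) / (2 * h) - (x : ℝ) ^ (2 * k) / (2 * k) := by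
        rw [integral_sub (integrable_kernelOne_sq x hh0) (integrable_kernelOne_sq x hk0),
          integral_kernelOne_sq x hh0, integral_kernelOne_sq x hk0]
    _ ≤ 1 / (2 * h) - 1 / (2 * k) := by
        -- With `y = x ^ (2h)`, Bernoulli's inequality `y ^ (k/h) ≥ 1 + (k/h)(y - 1)` shows that the
        -- difference is largest at `x = 1`.
        set y : ℝ := (x : ℝ) ^ (2 * h)
        have hy0 : 0 ≤ y := Real.rpow_nonneg x.2 _
        have hy : (x : ℝ) ^ (2 * k) = y ^ (k / h) := by
          rw [← Real.rpow_mul x.coe_nonneg]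
          congr 1
          field_simp
        have hB := one_add_mul_self_le_rpow_one_add (s := y - 1) (by linarith)
          ((one_le_div hh0).2 hhk)
        rw [add_sub_cancel, ← hy] at hB
        have e : y / (2 * h) - 1 / (2 * h) = (k / h * (y - 1)) / (2 * k) := by field_simp
        have : (1 + k / h * (y - 1)) / (2 * k) ≤ (x : ℝ) ^ (2 * k) / (2 * k) := by gcongr
        rw [add_div] at this
        linarith
    _ = (k - h) / (2 * (h * k)) := by field_simp
    _ ≤ (k - h) / (2 * a ^ 2) := by
        gcongr
        nlinarith

theorem rpow_sub_rpow_le {x y : ℝ} (hx : 0 ≤ x) (hxy : x ≤ y) {p : ℝ} (hp : 0 ≤ p)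
    (hp1 : p ≤ 1) : y ^ p - x ^ p ≤ (y - x) ^ p := by
  have := Real.rpow_add_le_add_rpow hx (sub_nonneg.2 hxy) hp hp1
  rw [add_sub_cancel] at this
  linarith

/-- For `h ≥ 1/2` the kernel increases with time everywhere. For `h ≤ 1/2` it decreases on `u < x`,
and the new mass on `[x, y]` is counted separately. -/
theorem integral_kernelOne_sub_sq_time {a : ℝ} (ha : 0 < a) {x y : ℝ≥0} (hxy : x ≤ y)
    (hy : y ≤ 1) {h : ℝ} (hh : a ≤ h) (hh1 : h ≤ 1) :
    ∫ u, (kernelOne x h u - kernelOne y h u) ^ 2 ∂halfLine ≤ ((y : ℝ) - x) ^ a / a := by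
  have hh0 : 0 < h := ha.trans_le hh
  have hxy' : (x : ℝ) ≤ y := by exact_mod_cast hxy
  have hy' : (y : ℝ) ≤ 1 := by exact_mod_cast hy
  have hx0 := x.coe_nonneg
  have ix := integrable_kernelOne_sq x hh0
  have iy := integrable_kernelOne_sq y hh0
  have hexp : ∀ b, a ≤ b → ((y : ℝ) - x) ^ b ≤ ((y : ℝ) - x) ^ a := fun b hb => by
    rcases hxy'.eq_or_lt with e | e
    · rw [← e, sub_self, Real.zero_rpow ha.ne', Real.zero_rpow (ha.trans_le hb).ne']
    · exact Real.rpow_le_rpow_of_exponent_ge (by linarith) (by linarith) hb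
  rcases le_total (1 / 2) h with hc | hc
  · calc ∫ u, (kernelOne x h u - kernelOne y h u) ^ 2 ∂halfLine
        ≤ ∫ u, (kernelOne y h u ^ 2 - kernelOne x h u ^ 2) ∂halfLine := by
          refine integral_mono (integrable_kernelOne_sub_sq x y hh0 hh0) (iy.sub ix) fun u => ?_
          simp only
          rw [sub_sq_comm]
          refine sub_sq_le_sq_sub_sq (kernelOne_nonneg _ _ _) ?_
          rcases lt_or_ge u x with hu | hu
          · rw [kernelOne_of_lt hu, kernelOne_of_lt (hu.trans_le hxy)]
            have hu' : (u : ℝ) < x := by exact_mod_cast hu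
            exact Real.rpow_le_rpow (by linarith) (by linarith) (by linarith)
          · rw [kernelOne_of_le hu]
            exact kernelOne_nonneg _ _ _
      _ = ((y : ℝ) ^ h - (x : ℝ) ^ h) * ((y : ℝ) ^ h + (x : ℝ) ^ h) / (2 * h) := by
          rw [integral_sub iy ix, integral_kernelOne_sq x hh0, integral_kernelOne_sq y hh0,
            mul_comm 2 h, Real.rpow_mul x.coe_nonneg, Real.rpow_mul y.coe_nonneg, Real.rpow_two, Real.rpow_two]
          ring
      _ ≤ ((y : ℝ) - x) ^ a * 2 / (2 * a) := by
          have h1 := rpow_sub_rpow_le hx0 hxy' hh0.le hh1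
          have h2 : (y : ℝ) ^ h ≤ 1 := Real.rpow_le_one y.2 hy' hh0.le
          have h3 : (x : ℝ) ^ h ≤ 1 := Real.rpow_le_one x.2 (hxy'.trans hy') hh0.le
          have h4 := hexp h hh
          have h5 : 0 ≤ (x : ℝ) ^ h := Real.rpow_nonneg x.2 _
          have h6 : 0 ≤ (y : ℝ) ^ h := Real.rpow_nonneg y.2 _
          have h7 : 0 ≤ ((y : ℝ) - x) ^ a := Real.rpow_nonneg (by linarith) _
          gcongr <;> linarith
      _ = _ := by field_simp
  · have iyx := (integral_kernelOne_sq_Ici hxy hh0).1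
    have eyx := (integral_kernelOne_sq_Ici hxy hh0).2
    rw [← integrable_indicator_iff measurableSet_Ici] at iyx
    rw [← integral_indicator measurableSet_Ici] at eyx
    set G := (Set.Ici x).indicator fun u => kernelOne y h u ^ 2
    have h1 := rpow_sub_rpow_le hx0 hxy' (p := 2 * h) (by linarith) (by linarith)
    have h2 : (x : ℝ) ^ (2 * h) ≤ (y : ℝ) ^ (2 * h) := Real.rpow_le_rpow hx0 hxy' (by linarith)
    have h4 := hexp (2 * h) (by linarith)
    have h7 : 0 ≤ ((y : ℝ) - x) ^ (2 * h) := Real.rpow_nonneg (by linarith) _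
    -- On `u ≥ x` the kernel at `x` is zero, so the squared difference is `-B² + 2B²`, with `B` the
    -- kernel at `y`; `G` supplies the second term.
    calc ∫ u, (kernelOne x h u - kernelOne y h u) ^ 2 ∂halfLine
        ≤ ∫ u, (kernelOne x h u ^ 2 - kernelOne y h u ^ 2 + 2 * G u) ∂halfLine := by
          refine integral_mono (integrable_kernelOne_sub_sq x y hh0 hh0)
            ((ix.sub iy).add (iyx.const_mul 2)) fun u => ?_
          simp only
          rcases lt_or_ge u x with hu | hu
          · have e : G u = 0 := Set.indicator_of_notMem (by simpa using hu) _
            rw [e, mul_zero, add_zero]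
            refine sub_sq_le_sq_sub_sq (kernelOne_nonneg _ _ _) ?_
            rw [kernelOne_of_lt hu, kernelOne_of_lt (hu.trans_le hxy)]
            have hu' : (u : ℝ) < x := by exact_mod_cast hu
            exact Real.rpow_le_rpow_of_nonpos (by linarith) (by linarith) (by linarith)
          · have e : G u = kernelOne y h u ^ 2 := Set.indicator_of_mem (Set.mem_Ici.2 hu) _
            rw [e, kernelOne_of_le hu]
            linarith
      _ = ((x : ℝ) ^ (2 * h) - (y : ℝ) ^ (2 * h) + 2 * ((y : ℝ) - x) ^ (2 * h)) / (2 * h) := by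
          have iG := iyx.const_mul 2
          rw [integral_add (f := fun u => kernelOne x h u ^ 2 - kernelOne y h u ^ 2) (ix.sub iy) iG,
            integral_sub ix iy,
            integral_const_mul, integral_kernelOne_sq x hh0, integral_kernelOne_sq y hh0, eyx]
          ring
      _ ≤ 2 * ((y : ℝ) - x) ^ a / (2 * a) := by
          gcongr
          linarith
      _ = _ := by field_simp

/-- The one-parameter kernel is Hölder continuous in `L²` in both parameters. -/
theorem integral_kernelOne_sub_sq_le {a : ℝ} (ha : 0 < a) {x y : ℝ≥0} (hx : x ≤ 1) (hy : y ≤ 1)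
    {h k : ℝ} (hh : a ≤ h) (hk : a ≤ k) (hk1 : k ≤ 1) :
    ∫ u, (kernelOne x h u - kernelOne y k u) ^ 2 ∂halfLine ≤
      |h - k| / a ^ 2 + 2 * dist x y ^ a / a := by
  have hh0 : 0 < h := ha.trans_le hh
  have hk0 : 0 < k := ha.trans_le hk
  have h1 : ∫ u, (kernelOne x h u - kernelOne x k u) ^ 2 ∂halfLine ≤ |h - k| / (2 * a ^ 2) := by
    rcases le_total h k with e | e
    · rw [abs_sub_comm, abs_of_nonneg (sub_nonneg.2 e)]
      exact integral_kernelOne_sub_sq_exponent ha hx hh e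
    · rw [abs_of_nonneg (sub_nonneg.2 e)]
      simp_rw [sub_sq_comm (kernelOne x h _)]
      exact integral_kernelOne_sub_sq_exponent ha hx hk e
  have h2 : ∫ u, (kernelOne x k u - kernelOne y k u) ^ 2 ∂halfLine ≤ dist x y ^ a / a := by
    rw [NNReal.dist_eq]
    rcases le_total x y with e | e
    · rw [abs_sub_comm, abs_of_nonneg (sub_nonneg.2 (by exact_mod_cast e))]
      exact integral_kernelOne_sub_sq_time ha e hy hk hk1
    · rw [abs_of_nonneg (sub_nonneg.2 (by exact_mod_cast e))]
      simp_rw [sub_sq_comm (kernelOne x k _)]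
      exact integral_kernelOne_sub_sq_time ha e hx hk hk1
  have i1 := integrable_kernelOne_sub_sq x x hh0 hk0
  have i2 := integrable_kernelOne_sub_sq x y hk0 hk0
  -- Pass through the kernel at time `x` with exponent `k`, using `(v + w)² ≤ 2v² + 2w²`.
  calc ∫ u, (kernelOne x h u - kernelOne y k u) ^ 2 ∂halfLine
      ≤ ∫ u, (2 * (kernelOne x h u - kernelOne x k u) ^ 2 +
          2 * (kernelOne x k u - kernelOne y k u) ^ 2) ∂halfLine := by
        refine integral_mono (integrable_kernelOne_sub_sq x y hh0 hk0)
          ((i1.const_mul 2).add (i2.const_mul 2)) fun u => ?_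
        simp only
        nlinarith [sq_nonneg (kernelOne x h u - kernelOne x k u -
          (kernelOne x k u - kernelOne y k u))]
    _ ≤ 2 * (|h - k| / (2 * a ^ 2)) + 2 * (dist x y ^ a / a) := by
        rw [integral_add (i1.const_mul 2) (i2.const_mul 2), integral_const_mul,
          integral_const_mul]
        gcongr
    _ = _ := by
        field_simp

/-! ### The Kolmogorov continuity criterion -/

section Chaining

variable {T : Type*} [PseudoEMetricSpace T] {D : ℕ → Finset T} {π : ℕ → T → T}

open Classical in
/-- The sum over all pairs of points of the `n`-th and `(n+1)`-st net at distance at most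
`3 * 2⁻ⁿ` of the `p`-th powers of the increments of `f`. -/
noncomputable def chainSum (D : ℕ → Finset T) (p : ℝ) (f : T → ℝ) (n : ℕ) : ℝ≥0∞ :=
  ∑ a ∈ D n ∪ D (n + 1), ∑ b ∈ D n ∪ D (n + 1),
    if edist a b ≤ 3 * 2⁻¹ ^ n then edist (f a) (f b) ^ p else 0

theorem edist_rpow_le_chainSum {p : ℝ} (f : T → ℝ) {n : ℕ} {a b : T}
    (ha : a ∈ D n ∨ a ∈ D (n + 1)) (hb : b ∈ D n ∨ b ∈ D (n + 1))
    (hab : edist a b ≤ 3 * 2⁻¹ ^ n) :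
    edist (f a) (f b) ^ p ≤ chainSum D p f n := by
  classical
  calc edist (f a) (f b) ^ p
      = if edist a b ≤ 3 * 2⁻¹ ^ n then edist (f a) (f b) ^ p else 0 := by rw [if_pos hab]
    _ ≤ ∑ b ∈ D n ∪ D (n + 1), if edist a b ≤ 3 * 2⁻¹ ^ n then edist (f a) (f b) ^ p else 0 :=
        Finset.single_le_sum (f := fun b => if edist a b ≤ 3 * 2⁻¹ ^ n then
          edist (f a) (f b) ^ p else 0) (fun _ _ => zero_le) (Finset.mem_union.2 hb)
    _ ≤ chainSum D p f n :=
        Finset.single_le_sum (f := fun a => ∑ b ∈ D n ∪ D (n + 1),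
          if edist a b ≤ 3 * 2⁻¹ ^ n then edist (f a) (f b) ^ p else 0)
          (fun _ _ => zero_le) (Finset.mem_union.2 ha)

/-- Along nets `D n` with projections `π n`, a function with geometrically decaying chain sums has
a continuous limit. -/
theorem exists_continuous_tendsto_of_chainSum_le (hπ : ∀ n t, π n t ∈ D n)
    (hd : ∀ n t, edist t (π n t) ≤ 2⁻¹ ^ n) {p : ℝ} (hp : 0 < p) {f : T → ℝ} {C r : ℝ≥0}
    (hr : r < 1) (h : ∀ n, chainSum D p f n ≤ C * r ^ n) :
    ∃ g : T → ℝ, Continuous g ∧ ∀ t, Tendsto (fun n => f (π n t)) atTop (𝓝 (g t)) := by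
  set c : ℝ≥0 := C ^ p⁻¹
  set ρ : ℝ≥0 := r ^ p⁻¹
  have hρ : ρ < 1 := NNReal.rpow_lt_one hr (inv_pos.2 hp)
  -- The radius `3 * 2⁻ⁿ` serves two purposes: successive projections of a point are within `2 *
  -- 2⁻ⁿ`, and level-`n` projections of points `2⁻ⁿ` apart are within `3 * 2⁻ⁿ`.
  have step : ∀ n a b, (a ∈ D n ∨ a ∈ D (n + 1)) → (b ∈ D n ∨ b ∈ D (n + 1)) →
      edist a b ≤ 3 * 2⁻¹ ^ n → dist (f a) (f b) ≤ c * (ρ : ℝ) ^ n := by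
    intro n a b ha hb hab
    have h1 := (edist_rpow_le_chainSum (p := p) f ha hb hab).trans (h n)
    have h2 : edist (f a) (f b) ≤ ((c * ρ ^ n : ℝ≥0) : ℝ≥0∞) := by
      have h3 := ENNReal.rpow_le_rpow h1 (inv_nonneg.2 hp.le)
      rw [ENNReal.rpow_rpow_inv hp.ne'] at h3
      refine h3.trans_eq ?_
      rw [← ENNReal.coe_pow, ← ENNReal.coe_mul, ← ENNReal.coe_rpow_of_nonneg _ (inv_nonneg.2 hp.le),
        NNReal.mul_rpow, ← NNReal.rpow_natCast, ← NNReal.rpow_natCast, ← NNReal.rpow_mul,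
        ← NNReal.rpow_mul, mul_comm (n : ℝ)]
    rw [edist_nndist, ENNReal.coe_le_coe] at h2
    rw [← coe_nndist]
    exact_mod_cast h2
  have hsucc : ∀ n t, dist (f (π n t)) (f (π (n + 1) t)) ≤ c * (ρ : ℝ) ^ n := by
    intro n t
    refine step n _ _ (Or.inl (hπ n t)) (Or.inr (hπ (n + 1) t)) ?_
    calc edist (π n t) (π (n + 1) t) ≤ edist t (π n t) + edist t (π (n + 1) t) :=
          edist_triangle_left _ _ _
      _ ≤ 2⁻¹ ^ n + 2⁻¹ ^ n := by
          gcongr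
          · exact hd n t
          · refine (hd (n + 1) t).trans ?_
            exact pow_le_pow_right_of_le_one' (by norm_num) (Nat.le_succ n)
      _ = 2 * 2⁻¹ ^ n := by ring
      _ ≤ 3 * 2⁻¹ ^ n := by gcongr; norm_num
  have hρ' : (ρ : ℝ) < 1 := by exact_mod_cast hρ
  have hlim : ∀ t, ∃ y, Tendsto (fun n => f (π n t)) atTop (𝓝 y) := fun t =>
    cauchySeq_tendsto_of_complete (cauchySeq_of_le_geometric _ _ hρ' fun n => hsucc n t)
  choose g hg using hlim
  have hfg : ∀ n t, dist (f (π n t)) (g t) ≤ c * (ρ : ℝ) ^ n / (1 - ρ) := fun n t =>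
    dist_le_of_le_geometric_of_tendsto _ _ hρ' (fun n => hsucc n t) (hg t) n
  refine ⟨g, ?_, hg⟩
  have hclose : ∀ n s t, edist s t ≤ 2⁻¹ ^ n →
      dist (g s) (g t) ≤ (2 * (c / (1 - ρ)) + c) * (ρ : ℝ) ^ n := by
    intro n s t hst
    have h1 : dist (f (π n s)) (f (π n t)) ≤ c * (ρ : ℝ) ^ n := by
      refine step n _ _ (Or.inl (hπ n s)) (Or.inl (hπ n t)) ?_
      calc edist (π n s) (π n t) ≤ edist (π n s) s + edist s t + edist t (π n t) :=
            edist_triangle4 _ _ _ _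
        _ ≤ 2⁻¹ ^ n + 2⁻¹ ^ n + 2⁻¹ ^ n := by
            gcongr
            · rw [edist_comm]; exact hd n s
            · exact hd n t
        _ = 3 * 2⁻¹ ^ n := by ring
    calc dist (g s) (g t)
        ≤ dist (g s) (f (π n s)) + dist (f (π n s)) (f (π n t)) + dist (f (π n t)) (g t) :=
          dist_triangle4 _ _ _ _
      _ ≤ c * (ρ : ℝ) ^ n / (1 - ρ) + c * (ρ : ℝ) ^ n + c * (ρ : ℝ) ^ n / (1 - ρ) := by
          gcongr
          · rw [dist_comm]; exact hfg n s
          · exact hfg n t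
      _ = _ := by ring
  have h0 : Tendsto (fun n : ℕ => (2 * (c / (1 - ρ)) + c) * (ρ : ℝ) ^ n) atTop (𝓝 0) := by
    simpa using (tendsto_pow_atTop_nhds_zero_of_lt_one ρ.2 hρ').const_mul
      (2 * (c / (1 - (ρ : ℝ))) + c)
  rw [continuous_iff_continuousAt]
  intro t
  rw [ContinuousAt, Metric.tendsto_nhds]
  intro ε hε
  obtain ⟨n, hn⟩ := (h0.eventually_lt_const hε).exists
  filter_upwards [Metric.closedEBall_mem_nhds t (ε := 2⁻¹ ^ n) (ENNReal.pow_pos (by simp) n)] with s hs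
  exact (hclose n s t hs).trans_lt hn

/-- Each close pair contributes at most `M (3 * 2⁻ⁿ) ^ q`. The number of close pairs is crudely
bounded by the number of all pairs, of order `2 ^ (2nm)`; this is why the criterion below asks for
`q > 2m`. -/
theorem lintegral_chainSum_le {Ω : Type*} {mΩ : MeasurableSpace Ω} {P : Measure Ω}
    {X : T → Ω → ℝ} {p q : ℝ} {M : ℝ≥0} (hX : IsKolmogorovProcess X P p q M) {K m : ℕ}
    (hD : ∀ n, (D n).card ≤ K * 2 ^ (n * m)) (n : ℕ) :
    ∫⁻ ω, chainSum D p (fun t => X t ω) n ∂P ≤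
      ((2 * K * 2 ^ m) ^ 2 * M * 3 ^ q : ℝ≥0) * ((2 ^ (2 * m - q) : ℝ≥0) : ℝ≥0∞) ^ n := by
  classical
  have hmeas : ∀ a b, Measurable fun ω =>
      if edist a b ≤ 3 * 2⁻¹ ^ n then edist (X a ω) (X b ω) ^ p else 0 := by
    intro a b
    split_ifs
    · exact hX.measurable_edist.pow_const p
    · exact measurable_const
  set N : Finset T := D n ∪ D (n + 1)
  have hN : N.card ≤ 2 * K * 2 ^ m * 2 ^ (n * m) := by
    refine (Finset.card_union_le _ _).trans ((add_le_add (hD n) (hD (n + 1))).trans ?_)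
    have h1 : K * 2 ^ (n * m) ≤ K * 2 ^ m * 2 ^ (n * m) := by
      rw [mul_right_comm]
      exact Nat.le_mul_of_pos_right _ (by positivity)
    have h2 : K * 2 ^ ((n + 1) * m) = K * 2 ^ m * 2 ^ (n * m) := by ring
    rw [h2]
    linarith
  have hterm : ∀ a b, ∫⁻ ω, (if edist a b ≤ 3 * 2⁻¹ ^ n then edist (X a ω) (X b ω) ^ p else 0) ∂P
      ≤ M * (3 * 2⁻¹ ^ n) ^ q := by
    intro a b
    split_ifs with hab
    · refine (hX.kolmogorovCondition a b).trans ?_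
      gcongr
      exact hX.q_pos.le
    · simp
  calc ∫⁻ ω, chainSum D p (fun t => X t ω) n ∂P
      = ∑ a ∈ N, ∑ b ∈ N,
        ∫⁻ ω, (if edist a b ≤ 3 * 2⁻¹ ^ n then edist (X a ω) (X b ω) ^ p else 0) ∂P := by
        simp only [chainSum]
        rw [lintegral_finsetSum _ fun a _ => Finset.measurable_fun_sum _ fun b _ => hmeas a b]
        exact Finset.sum_congr rfl fun a _ => lintegral_finsetSum _ fun b _ => hmeas a b
    _ ≤ ∑ a ∈ N, ∑ b ∈ N, (M * (3 * 2⁻¹ ^ n) ^ q : ℝ≥0∞) :=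
        Finset.sum_le_sum fun a _ => Finset.sum_le_sum fun b _ => hterm a b
    _ = (N.card : ℝ≥0∞) ^ 2 * (M * (3 * 2⁻¹ ^ n) ^ q) := by
        simp only [Finset.sum_const, nsmul_eq_mul]
        ring
    _ ≤ ((2 * K * 2 ^ m * 2 ^ (n * m) : ℕ) : ℝ≥0∞) ^ 2 * (M * (3 * 2⁻¹ ^ n) ^ q) := by
        gcongr
    _ = (((2 * K * 2 ^ m * 2 ^ (n * m)) ^ 2 * (M * (3 * 2⁻¹ ^ n) ^ q) : ℝ≥0) : ℝ≥0∞) := by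
        push_cast
        rw [ENNReal.coe_rpow_of_nonneg _ hX.q_pos.le]
        push_cast
        rfl
    _ = _ := by
        rw [← ENNReal.coe_pow, ← ENNReal.coe_mul]
        congr 1
        rw [NNReal.mul_rpow, NNReal.rpow_sub (by norm_num), div_pow, ← NNReal.rpow_natCast _ n,
          ← NNReal.rpow_natCast _ n, ← NNReal.rpow_natCast _ n, NNReal.inv_rpow, NNReal.inv_rpow,
          ← NNReal.rpow_mul, ← NNReal.rpow_mul, ← NNReal.rpow_mul, mul_comm (n : ℝ) q]
        have : (2 : ℝ≥0) ^ (2 * (m : ℝ) * n) = (2 ^ (n * m)) ^ 2 := by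
          rw [← NNReal.rpow_natCast, ← NNReal.rpow_natCast, ← NNReal.rpow_mul]
          push_cast
          ring_nf
        rw [this]
        ring

/-- **Kolmogorov's continuity criterion** on a space with nets of polynomial growth. -/
theorem exists_continuous_modification {Ω : Type*} {mΩ : MeasurableSpace Ω} {P : Measure Ω}
    {X : T → Ω → ℝ} {p q : ℝ} {M : ℝ≥0} (hX : IsKolmogorovProcess X P p q M) {K m : ℕ}
    (hD : ∀ n, (D n).card ≤ K * 2 ^ (n * m)) (hπ : ∀ n t, π n t ∈ D n)
    (hd : ∀ n t, edist t (π n t) ≤ 2⁻¹ ^ n) (hq : 2 * m < q) :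
    ∃ Y : T → Ω → ℝ, (∀ t, Measurable (Y t)) ∧ (∀ ω, Continuous fun t => Y t ω) ∧
      ∀ t, Y t =ᵐ[P] X t := by
  classical
  set B : ℕ → Ω → ℝ≥0∞ := fun n ω => chainSum D p (fun t => X t ω) n
  have hBm : ∀ n, Measurable (B n) := by
    intro n
    refine Finset.measurable_fun_sum _ fun a _ => Finset.measurable_fun_sum _ fun b _ => ?_
    split_ifs
    · exact hX.measurable_edist.pow_const p
    · exact measurable_const
  set a : ℝ≥0 := 2 ^ (2 * m - q)
  have ha1 : a < 1 := NNReal.rpow_lt_one_of_one_lt_of_neg (by norm_num) (by linarith)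
  have ha0 : 0 < a := NNReal.rpow_pos (by norm_num)
  -- The expected chain sums decay like `aⁿ`. For `a < r < 1` the series weighted by `r⁻ⁿ` still has
  -- finite expectation, and where it is finite it bounds the `n`-th chain sum by `S ω * r ^ n`.
  obtain ⟨r, har, hr1⟩ := exists_between ha1
  have hr0 : 0 < r := ha0.trans har
  set S : Ω → ℝ≥0∞ := fun ω => ∑' n, B n ω * ((r⁻¹ : ℝ≥0) : ℝ≥0∞) ^ n
  have hSm : Measurable S := Measurable.tsum fun n => (hBm n).mul_const _
  have hSint : ∫⁻ ω, S ω ∂P ≠ ∞ := by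
    simp only [S]
    rw [lintegral_tsum fun n => ((hBm n).mul_const _).aemeasurable]
    simp_rw [lintegral_mul_const _ (hBm _)]
    refine ne_top_of_le_ne_top ?_ (ENNReal.tsum_le_tsum fun n =>
      mul_le_mul_left (lintegral_chainSum_le hX hD n) _)
    have : ∀ n : ℕ, ((2 * K * 2 ^ m) ^ 2 * M * 3 ^ q : ℝ≥0) * (a : ℝ≥0∞) ^ n *
        ((r⁻¹ : ℝ≥0) : ℝ≥0∞) ^ n =
        (((2 * K * 2 ^ m) ^ 2 * M * 3 ^ q * (a * r⁻¹) ^ n : ℝ≥0) : ℝ≥0∞) := by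
      intro n
      push_cast
      rw [mul_pow]
      ring
    rw [tsum_congr this, ENNReal.tsum_coe_ne_top_iff_summable]
    refine Summable.mul_left _ (NNReal.summable_geometric ?_)
    rw [← div_eq_mul_inv]
    exact (div_lt_one hr0).2 har
  have hSfin : ∀ᵐ ω ∂P, S ω < ∞ := ae_lt_top hSm hSint
  have hgood : ∀ ω, S ω < ∞ → ∃ g : T → ℝ, Continuous g ∧
      ∀ t, Tendsto (fun n => X (π n t) ω) atTop (𝓝 (g t)) := by
    intro ω hω
    refine exists_continuous_tendsto_of_chainSum_le hπ hd hX.p_pos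
      (f := fun t => X t ω) (C := (S ω).toNNReal) hr1 ?_
    intro n
    have h1 : B n ω * ((r⁻¹ : ℝ≥0) : ℝ≥0∞) ^ n ≤ S ω :=
      ENNReal.le_tsum (f := fun n => B n ω * ((r⁻¹ : ℝ≥0) : ℝ≥0∞) ^ n) n
    rw [ENNReal.coe_toNNReal hω.ne]
    calc B n ω = B n ω * ((r⁻¹ : ℝ≥0) : ℝ≥0∞) ^ n * (r : ℝ≥0∞) ^ n := by
          rw [mul_assoc, ← mul_pow, ← ENNReal.coe_mul, inv_mul_cancel₀ hr0.ne']
          simp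
      _ ≤ S ω * (r : ℝ≥0∞) ^ n := by gcongr
  choose! g hgc hgt using hgood
  -- Setting `Y = 0` on the exceptional null event makes every path continuous.
  set Y : T → Ω → ℝ := fun t ω => if S ω < ∞ then g ω t else 0
  have hYt : ∀ t ω, Tendsto (fun n => if S ω < ∞ then X (π n t) ω else 0) atTop (𝓝 (Y t ω)) := by
    intro t ω
    by_cases hω : S ω < ∞
    · simpa [Y, hω] using hgt ω hω t
    · simp [Y, hω]
  have hSset : MeasurableSet {ω | S ω < ∞} := measurableSet_lt hSm measurable_const
  refine ⟨Y, fun t => ?_, fun ω => ?_, fun t => ?_⟩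
  · exact measurable_of_tendsto_metrizable
      (fun n => Measurable.ite hSset (hX.measurable (π n t)) measurable_const)
      (tendsto_pi_nhds.2 fun ω => hYt t ω)
  · by_cases hω : S ω < ∞
    · simpa [Y, hω] using hgc ω hω
    · simp [Y, hω, continuous_const]
  · have hYlim : ∀ᵐ ω ∂P, Tendsto (fun n => X (π n t) ω) atTop (𝓝 (Y t ω)) := by
      filter_upwards [hSfin] with ω hω
      simpa [hω] using hYt t ω
    have hXlim : Tendsto (fun n => ∫⁻ ω, edist (X t ω) (X (π n t) ω) ^ p ∂P) atTop (𝓝 0) := by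
      have h0 : Tendsto (fun n : ℕ => (M : ℝ≥0∞) * ((2⁻¹ : ℝ≥0∞) ^ n) ^ q) atTop (𝓝 0) := by
        have h1 : Tendsto (fun n : ℕ => ((2⁻¹ : ℝ≥0∞) ^ n)) atTop (𝓝 0) :=
          ENNReal.tendsto_pow_atTop_nhds_zero_of_lt_one (by norm_num)
        have h2 := (ENNReal.continuous_rpow_const (y := q)).tendsto 0 |>.comp h1
        rw [ENNReal.zero_rpow_of_pos hX.q_pos] at h2
        simpa using ENNReal.Tendsto.const_mul h2 (Or.inr ENNReal.coe_ne_top)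
      refine tendsto_of_tendsto_of_tendsto_of_le_of_le tendsto_const_nhds h0
        (fun _ => zero_le) fun n => ?_
      refine (hX.kolmogorovCondition t (π n t)).trans ?_
      gcongr
      · exact hX.q_pos.le
      · exact hd n t
    -- Fatou's lemma: `X (π n t)` tends to `Y t` almost surely and to `X t` in `p`-th mean.
    have hzero : ∫⁻ ω, edist (X t ω) (Y t ω) ^ p ∂P = 0 := by
      refine le_antisymm ?_ (zero_le)
      calc ∫⁻ ω, edist (X t ω) (Y t ω) ^ p ∂P
          ≤ ∫⁻ ω, liminf (fun n => edist (X t ω) (X (π n t) ω) ^ p) atTop ∂P := by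
            refine lintegral_mono_ae ?_
            filter_upwards [hYlim] with ω hω
            refine le_of_eq (Tendsto.liminf_eq ?_).symm
            exact (ENNReal.continuous_rpow_const.tendsto _).comp (tendsto_const_nhds.edist hω)
        _ ≤ liminf (fun n => ∫⁻ ω, edist (X t ω) (X (π n t) ω) ^ p ∂P) atTop :=
            lintegral_liminf_le fun n => hX.measurable_edist.pow_const p
        _ = 0 := hXlim.liminf_eq
    have hYm : Measurable (Y t) := measurable_of_tendsto_metrizable
      (fun n => Measurable.ite hSset (hX.measurable (π n t)) measurable_const)
      (tendsto_pi_nhds.2 fun ω => hYt t ω)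
    rw [lintegral_eq_zero_iff (((hX.measurable t).edist hYm).pow_const p)] at hzero
    filter_upwards [hzero] with ω hω
    have : edist (X t ω) (Y t ω) = 0 := by
      simpa [hX.p_pos, hX.p_pos.le, not_lt.2 hX.p_pos.le] using hω
    exact (edist_eq_zero.1 this).symm

end Chaining

/-! ### The kernel of the sheet -/

theorem kernel_eq_prod {d : ℕ} (H : (Fin d → ℝ≥0) → Fin d → ℝ) (t u : Fin d → ℝ≥0) :
    kernel H t u = ∏ i, kernelOne (t i) (H t i) (u i) := rfl

theorem memLp_prod {d : ℕ} {f : Fin d → ℝ≥0 → ℝ} (hf : ∀ i, Measurable (f i))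
    (hf2 : ∀ i, MemLp (f i) 2 halfLine) :
    MemLp (fun u => ∏ i, f i (u i)) 2 (lebesgue d) := by
  have hm : Measurable fun u : Fin d → ℝ≥0 => ∏ i, f i (u i) :=
    Finset.measurable_fun_prod _ fun i _ => (hf i).comp (measurable_pi_apply i)
  rw [memLp_two_iff_integrable_sq hm.aestronglyMeasurable]
  simp_rw [← Finset.prod_pow]
  exact Integrable.fintype_prod fun i => (hf2 i).integrable_sq

theorem memLp_kernel {d : ℕ} {H : (Fin d → ℝ≥0) → Fin d → ℝ} {t : Fin d → ℝ≥0}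
    (hH : ∀ i, 0 < H t i) : MemLp (kernel H t) 2 (lebesgue d) :=
  memLp_prod (fun _ => measurable_kernelOne _ _) fun i => memLp_kernelOne _ (hH i)

/-- Telescoping, replacing one factor at a time; `1 ≤ M` lets every term carry the same power of
`M`. -/
theorem abs_prod_sub_prod_le {ι : Type*} (s : Finset ι) {A C : ι → ℝ} {M : ℝ} (hM : 1 ≤ M)
    (hA : ∀ i, |A i| ≤ M) (hC : ∀ i, |C i| ≤ M) :
    |∏ i ∈ s, A i - ∏ i ∈ s, C i| ≤ M ^ s.card * ∑ i ∈ s, |A i - C i| := by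
  classical
  induction s using Finset.induction_on with
  | empty => simp
  | insert a s ha ih =>
    rw [Finset.prod_insert ha, Finset.prod_insert ha, Finset.sum_insert ha,
      Finset.card_insert_of_notMem ha]
    have hC' : |∏ i ∈ s, C i| ≤ M ^ s.card := by
      rw [Finset.abs_prod]
      exact (Finset.prod_le_prod (fun i _ => abs_nonneg (C i)) fun i _ => hC i).trans_eq (by simp)
    calc |A a * ∏ i ∈ s, A i - C a * ∏ i ∈ s, C i|
        = |A a * (∏ i ∈ s, A i - ∏ i ∈ s, C i) + (A a - C a) * ∏ i ∈ s, C i| := by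
          congr 1
          ring
      _ ≤ |A a| * |∏ i ∈ s, A i - ∏ i ∈ s, C i| + |A a - C a| * |∏ i ∈ s, C i| := by
          rw [← abs_mul, ← abs_mul]
          exact abs_add_le _ _
      _ ≤ M * (M ^ s.card * ∑ i ∈ s, |A i - C i|) + |A a - C a| * (M ^ s.card * M) := by
          have h1 : M ^ s.card ≤ M ^ s.card * M := le_mul_of_one_le_right (by positivity) hM
          gcongr
          · exact hA a
          · exact hC'.trans h1
      _ = _ := by ring

/-- If the factors of two products are close in `L²`, so are the products. -/
theorem integral_prod_sub_prod_sq_le {d : ℕ} {f g : Fin d → ℝ≥0 → ℝ} {M ε : ℝ}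
    (hf : ∀ i, MemLp (f i) 2 halfLine) (hg : ∀ i, MemLp (g i) 2 halfLine) (hM : 1 ≤ M)
    (hfM : ∀ i, ∫ u, f i u ^ 2 ∂halfLine ≤ M) (hgM : ∀ i, ∫ u, g i u ^ 2 ∂halfLine ≤ M)
    (hε : 0 < ε) (hfg : ∀ i, ∫ u, (f i u - g i u) ^ 2 ∂halfLine ≤ ε ^ 2) :
    ∫ u, (∏ i, f i (u i) - ∏ i, g i (u i)) ^ 2 ∂lebesgue d ≤ 2 * (d * M ^ (d + 1)) * ε := by
  set A : Fin d → ℝ := fun i => ∫ u, f i u ^ 2 ∂halfLine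
  set B : Fin d → ℝ := fun i => ∫ u, g i u ^ 2 ∂halfLine
  set C : Fin d → ℝ := fun i => ∫ u, f i u * g i u ∂halfLine
  have iA := fun i => (hf i).integrable_sq
  have iB := fun i => (hg i).integrable_sq
  have iC : ∀ i, Integrable (fun u => f i u * g i u) halfLine :=
    fun i => (hf i).integrable_mul (hg i)
  have hA0 : ∀ i, 0 ≤ A i := fun i => integral_nonneg fun u => sq_nonneg _
  have hB0 : ∀ i, 0 ≤ B i := fun i => integral_nonneg fun u => sq_nonneg _
  have hD : ∀ i, ∫ u, (f i u - g i u) ^ 2 ∂halfLine = A i - 2 * C i + B i := by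
    intro i
    have i2 := (iC i).const_mul 2
    rw [← integral_const_mul, ← integral_sub (iA i) i2,
      ← integral_add (f := fun u => f i u ^ 2 - 2 * (f i u * g i u)) ((iA i).sub i2) (iB i)]
    refine integral_congr_ae (Eventually.of_forall fun u => ?_)
    simp only
    ring
  have hScale : ∀ i (a b : ℝ), 0 ≤ a ^ 2 * A i - 2 * (a * b) * C i + b ^ 2 * B i := by
    intro i a b
    have i2 := (iC i).const_mul (2 * (a * b))
    rw [← integral_const_mul, ← integral_const_mul, ← integral_const_mul,
      ← integral_sub ((iA i).const_mul _) i2,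
      ← integral_add (f := fun u => a ^ 2 * f i u ^ 2 - 2 * (a * b) * (f i u * g i u))
        (((iA i).const_mul _).sub i2) ((iB i).const_mul _)]
    refine integral_nonneg fun u => ?_
    have : a ^ 2 * f i u ^ 2 - 2 * (a * b) * (f i u * g i u) + b ^ 2 * g i u ^ 2 =
        (a * f i u - b * g i u) ^ 2 := by ring
    simp only [Pi.zero_apply]
    rw [this]
    positivity
  have hAM : ∀ i, |A i| ≤ M := fun i => by rw [abs_of_nonneg (hA0 i)]; exact hfM i
  have hBM : ∀ i, |B i| ≤ M := fun i => by rw [abs_of_nonneg (hB0 i)]; exact hgM i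
  have hCM : ∀ i, |C i| ≤ M := fun i => by
    have h1 := hScale i 1 1
    have h2 := hScale i 1 (-1)
    have h3 : A i ≤ M := hfM i
    have h4 : B i ≤ M := hgM i
    rw [abs_le]
    constructor <;> linarith
  -- the quadratic form of `(f, f - g)` at `(ε, ±1)`
  have hAC : ∀ i, |A i - C i| ≤ ε * M := fun i => by
    have h1 := hScale i (ε + 1) 1
    have h2 := hScale i (ε - 1) (-1)
    have h3 : A i ≤ M := hfM i
    have h5 := hfg i
    rw [hD] at h5
    -- Together `h1` and `h2` say `2ε|A - C| ≤ ε²A + ‖f - g‖² ≤ ε²(M + 1)`, which is at most `2ε²M`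
    -- because `1 ≤ M`.
    have h6 : ε * |A i - C i| ≤ ε * (ε * M) := by
      rw [← abs_of_pos hε, ← abs_mul, abs_of_pos hε, abs_le]
      constructor <;> nlinarith [mul_le_mul_of_nonneg_left h3 (sq_nonneg ε),
        mul_le_mul_of_nonneg_left hM (sq_nonneg ε)]
    exact le_of_mul_le_mul_left h6 hε
  have hBC : ∀ i, |B i - C i| ≤ ε * M := fun i => by
    have h1 := hScale i 1 (ε + 1)
    have h2 := hScale i (-1) (ε - 1)
    have h3 : B i ≤ M := hgM i
    have h5 := hfg i
    rw [hD] at h5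
    have h6 : ε * |B i - C i| ≤ ε * (ε * M) := by
      rw [← abs_of_pos hε, ← abs_mul, abs_of_pos hε, abs_le]
      constructor <;> nlinarith [mul_le_mul_of_nonneg_left h3 (sq_nonneg ε),
        mul_le_mul_of_nonneg_left hM (sq_nonneg ε)]
    exact le_of_mul_le_mul_left h6 hε
  have hprod : ∀ E : Fin d → ℝ, (∀ i, |E i| ≤ M) → (∀ i, |E i - C i| ≤ ε * M) →
      ∏ i, E i - ∏ i, C i ≤ d * M ^ (d + 1) * ε := by
    intro E hE hEC
    calc ∏ i, E i - ∏ i, C i ≤ |∏ i, E i - ∏ i, C i| := le_abs_self _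
      _ ≤ M ^ d * ∑ i, |E i - C i| := by
          simpa using abs_prod_sub_prod_le Finset.univ hM hE hCM
      _ ≤ M ^ d * ∑ _i : Fin d, ε * M := by
          gcongr with i
          exact hEC i
      _ = _ := by
          simp only [Finset.sum_const, Finset.card_univ, Fintype.card_fin, nsmul_eq_mul]
          ring
  have jA : Integrable (fun u : Fin d → ℝ≥0 => ∏ i, f i (u i) ^ 2) (lebesgue d) :=
    Integrable.fintype_prod (μ := fun _ => halfLine) (f := fun i v => f i v ^ 2) iA
  have jB : Integrable (fun u : Fin d → ℝ≥0 => ∏ i, g i (u i) ^ 2) (lebesgue d) :=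
    Integrable.fintype_prod (μ := fun _ => halfLine) (f := fun i v => g i v ^ 2) iB
  have jC : Integrable (fun u : Fin d → ℝ≥0 => ∏ i, f i (u i) * g i (u i)) (lebesgue d) :=
    Integrable.fintype_prod (μ := fun _ => halfLine) (f := fun i v => f i v * g i v) iC
  have eA : ∫ u, ∏ i, f i (u i) ^ 2 ∂lebesgue d = ∏ i, A i :=
    integral_fintype_prod_eq_prod (μ := fun _ => halfLine) (fun i v => f i v ^ 2)
  have eB : ∫ u, ∏ i, g i (u i) ^ 2 ∂lebesgue d = ∏ i, B i :=
    integral_fintype_prod_eq_prod (μ := fun _ => halfLine) (fun i v => g i v ^ 2)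
  have eC : ∫ u, ∏ i, f i (u i) * g i (u i) ∂lebesgue d = ∏ i, C i :=
    integral_fintype_prod_eq_prod (μ := fun _ => halfLine) (fun i v => f i v * g i v)
  -- By Fubini the integral equals `(∏ A - ∏ C) + (∏ B - ∏ C)`, and `hprod` bounds each bracket.
  have e : ∫ u, (∏ i, f i (u i) - ∏ i, g i (u i)) ^ 2 ∂lebesgue d =
      ∏ i, A i - 2 * ∏ i, C i + ∏ i, B i := by
    have j2 := jC.const_mul 2
    rw [← eA, ← eB, ← eC, ← integral_const_mul, ← integral_sub jA j2,
      ← integral_add (f := fun u : Fin d → ℝ≥0 =>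
        ∏ i, f i (u i) ^ 2 - 2 * ∏ i, f i (u i) * g i (u i)) (jA.sub j2) jB]
    refine integral_congr_ae (Eventually.of_forall fun u => ?_)
    simp only [Finset.prod_pow, Finset.prod_mul_distrib]
    ring
  rw [e]
  linarith [hprod A hAM hAC, hprod B hBM hBC]

/-! ### Dyadic grids of the unit cube -/

/-- The point of the unit cube with coordinates `k i / 2 ^ n`. -/
noncomputable def gridPoint {d : ℕ} (n : ℕ) (k : Fin d → Fin (2 ^ n + 1)) :
    Set.Icc (0 : Fin d → ℝ≥0) 1 :=
  ⟨fun i => ((k i : ℕ) : ℝ≥0) / 2 ^ n, fun _ => zero_le, fun i =>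
    div_le_one_of_le₀ (by exact_mod_cast Nat.lt_succ_iff.1 (k i).2) zero_le⟩

open Classical in
/-- The dyadic grid of mesh `2⁻ⁿ` in the unit cube. -/
noncomputable def grid (d n : ℕ) : Finset (Set.Icc (0 : Fin d → ℝ≥0) 1) :=
  Finset.univ.image (gridPoint n)

theorem card_grid_le (d n : ℕ) : (grid d n).card ≤ 2 ^ d * 2 ^ (n * d) := by
  refine Finset.card_image_le.trans ?_
  rw [Finset.card_univ, Fintype.card_fun, Fintype.card_fin, Fintype.card_fin, pow_mul, ← mul_pow]
  exact Nat.pow_le_pow_left (by linarith [Nat.one_le_two_pow (n := n)]) d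

/-- Rounding down to the dyadic grid. -/
noncomputable def gridFloor {d : ℕ} (n : ℕ) (t : Set.Icc (0 : Fin d → ℝ≥0) 1) :
    Set.Icc (0 : Fin d → ℝ≥0) 1 :=
  gridPoint n fun i => ⟨⌊t.1 i * 2 ^ n⌋₊, Nat.lt_succ_iff.2 (Nat.floor_le_of_le (by
    push_cast
    exact mul_le_of_le_one_left zero_le (t.2.2 i)))⟩

theorem gridFloor_mem {d : ℕ} (n : ℕ) (t : Set.Icc (0 : Fin d → ℝ≥0) 1) :
    gridFloor n t ∈ grid d n := by
  classical
  exact Finset.mem_image_of_mem _ (Finset.mem_univ _)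

theorem edist_gridFloor_le {d : ℕ} (n : ℕ) (t : Set.Icc (0 : Fin d → ℝ≥0) 1) :
    edist t (gridFloor n t) ≤ 2⁻¹ ^ n := by
  rw [Subtype.edist_eq, edist_pi_le_iff]
  intro i
  have h2 : (0 : ℝ) < 2 ^ n := by positivity
  have h : dist (t.1 i) ((gridFloor n t).1 i) ≤ (2⁻¹ : ℝ) ^ n := by
    have e : (gridFloor n t).1 i = ((⌊t.1 i * 2 ^ n⌋₊ : ℕ) : ℝ≥0) / 2 ^ n := rfl
    have h1 : (⌊t.1 i * 2 ^ n⌋₊ : ℝ) ≤ t.1 i * 2 ^ n := by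
      exact_mod_cast Nat.floor_le (zero_le : 0 ≤ t.1 i * 2 ^ n)
    have h3 : (t.1 i : ℝ) * 2 ^ n < ⌊t.1 i * 2 ^ n⌋₊ + 1 := by
      exact_mod_cast Nat.lt_floor_add_one (t.1 i * 2 ^ n)
    rw [e, NNReal.dist_eq]
    push_cast
    rw [abs_of_nonneg (sub_nonneg.2 ((div_le_iff₀ h2).2 h1)), inv_pow, sub_le_iff_le_add,
      inv_eq_one_div, ← add_div, le_div_iff₀ h2]
    linarith
  rw [edist_dist]
  refine (ENNReal.ofReal_le_ofReal h).trans_eq ?_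
  rw [ENNReal.ofReal_pow (by norm_num), ENNReal.ofReal_inv_of_pos (by norm_num)]
  norm_num

/-! ### Regularity of the sheet -/

theorem euclNorm_sub_le {d : ℕ} (s t : Fin d → ℝ≥0) :
    euclNorm (fun i => (t i : ℝ) - (s i : ℝ)) ≤ √d * dist t s := by
  rw [euclNorm, EuclideanSpace.norm_eq]
  calc √(∑ i, ‖(t i : ℝ) - (s i : ℝ)‖ ^ 2) ≤ √(∑ _i : Fin d, dist t s ^ 2) := by
        gcongr with i
        rw [Real.norm_eq_abs, ← NNReal.dist_eq]
        exact dist_le_pi_dist t s i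
    _ = √d * dist t s := by
        rw [Finset.sum_const, Finset.card_univ, Fintype.card_fin, nsmul_eq_mul,
          Real.sqrt_mul (Nat.cast_nonneg d), Real.sqrt_sq dist_nonneg]

theorem abs_apply_le_euclNorm {d : ℕ} (x : Fin d → ℝ) (i : Fin d) : |x i| ≤ euclNorm x :=
  PiLp.norm_apply_le (WithLp.toLp 2 x : EuclideanSpace ℝ (Fin d)) i

/-- The kernel of the sheet is Hölder continuous in `L²` on the unit cube. -/
theorem exists_integral_kernel_sub_sq_le {d : ℕ} {H : (Fin d → ℝ≥0) → Fin d → ℝ} {a γ K : ℝ}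
    (ha : 0 < a) (hH : ∀ i t, a ≤ H t i) (hH1 : ∀ i t, H t i ≤ 1) (hγ : 0 < γ)
    (hHolder : ∀ t s : Fin d → ℝ≥0, euclNorm (fun i => H t i - H s i) ≤
      K * euclNorm (fun i => (t i : ℝ) - (s i : ℝ)) ^ γ) :
    ∃ C η : ℝ, 0 ≤ C ∧ 0 < η ∧ ∀ s ∈ Set.Icc (0 : Fin d → ℝ≥0) 1,
      ∀ t ∈ Set.Icc (0 : Fin d → ℝ≥0) 1,
        ∫ u, (kernel H s u - kernel H t u) ^ 2 ∂lebesgue d ≤ C * dist s t ^ η := by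
  set η := min a γ
  have hη0 : 0 < η := lt_min ha hγ
  set C₀ : ℝ := |K| * √d ^ γ / a ^ 2 + 2 / a
  have hC₀ : 0 < C₀ := by positivity
  set M : ℝ := 1 + 1 / (2 * a)
  have hM : 1 ≤ M := le_add_of_nonneg_right (by positivity)
  -- The product bound is linear in `ε = √C₀ * δ ^ (η / 2)`, hence the halved exponent. As `ε` must
  -- be positive, `s = t` is treated apart.
  refine ⟨2 * (d * M ^ (d + 1)) * √C₀, η / 2, by positivity, by positivity, fun s hs t ht => ?_⟩
  rcases eq_or_ne s t with rfl | hst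
  · simp [Real.zero_rpow (by positivity : η / 2 ≠ 0)]
  set δ := dist s t
  have hδ0 : 0 < δ := dist_pos.2 hst
  have hcoord : ∀ i, dist (s i) (t i) ≤ δ := dist_le_pi_dist s t
  have hδ1 : δ ≤ 1 := by
    refine (dist_pi_le_iff zero_le_one).2 fun i => ?_
    have h1 : (s i : ℝ) ≤ 1 := by exact_mod_cast hs.2 i
    have h2 : (t i : ℝ) ≤ 1 := by exact_mod_cast ht.2 i
    rw [NNReal.dist_eq, abs_le]
    constructor <;> linarith [(s i).coe_nonneg, (t i).coe_nonneg]
  have hsq : ∀ v ∈ Set.Icc (0 : Fin d → ℝ≥0) 1, ∀ i,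
      ∫ u, kernelOne (v i) (H v i) u ^ 2 ∂halfLine ≤ M := by
    intro v hv i
    have hpos := ha.trans_le (hH i v)
    rw [integral_kernelOne_sq _ hpos]
    calc ((v i : ℝ)) ^ (2 * H v i) / (2 * H v i) ≤ 1 / (2 * a) := by
          gcongr
          · exact Real.rpow_le_one (v i).coe_nonneg (by exact_mod_cast hv.2 i) (by positivity)
          · exact hH i v
      _ ≤ M := by simp [M]
  have hpowa : δ ^ a ≤ δ ^ η := Real.rpow_le_rpow_of_exponent_ge hδ0 hδ1 (min_le_left _ _)
  have hpowγ : δ ^ γ ≤ δ ^ η := Real.rpow_le_rpow_of_exponent_ge hδ0 hδ1 (min_le_right _ _)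
  have hclose : ∀ i, ∫ u, (kernelOne (s i) (H s i) u - kernelOne (t i) (H t i) u) ^ 2 ∂halfLine ≤
      (√C₀ * δ ^ (η / 2)) ^ 2 := by
    intro i
    have hHi : |H s i - H t i| ≤ |K| * √d ^ γ * δ ^ η := by
      calc |H s i - H t i| ≤ euclNorm (fun i => H s i - H t i) :=
            abs_apply_le_euclNorm (fun i => H s i - H t i) i
        _ ≤ K * euclNorm (fun i => (s i : ℝ) - (t i : ℝ)) ^ γ := hHolder s t
        _ ≤ |K| * (√d * δ) ^ γ := by
            have h0 : 0 ≤ euclNorm (fun i => (s i : ℝ) - (t i : ℝ)) := norm_nonneg _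
            gcongr
            · exact le_abs_self K
            · exact euclNorm_sub_le t s
        _ = |K| * √d ^ γ * δ ^ γ := by
            rw [Real.mul_rpow (Real.sqrt_nonneg _) hδ0.le, mul_assoc]
        _ ≤ _ := by gcongr
    calc ∫ u, (kernelOne (s i) (H s i) u - kernelOne (t i) (H t i) u) ^ 2 ∂halfLine
        ≤ |H s i - H t i| / a ^ 2 + 2 * dist (s i) (t i) ^ a / a :=
          integral_kernelOne_sub_sq_le ha (hs.2 i) (ht.2 i) (hH i s) (hH i t) (hH1 i t)
      _ ≤ |K| * √d ^ γ * δ ^ η / a ^ 2 + 2 * δ ^ η / a := by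
          have : dist (s i) (t i) ^ a ≤ δ ^ η :=
            (Real.rpow_le_rpow dist_nonneg (hcoord i) ha.le).trans hpowa
          gcongr
      _ = C₀ * δ ^ η := by ring
      _ = (√C₀ * δ ^ (η / 2)) ^ 2 := by
          rw [mul_pow, Real.sq_sqrt hC₀.le, ← Real.rpow_natCast, ← Real.rpow_mul hδ0.le]
          norm_num
  have := integral_prod_sub_prod_sq_le (fun i => memLp_kernelOne (s i) (ha.trans_le (hH i s)))
    (fun i => memLp_kernelOne (t i) (ha.trans_le (hH i t))) hM (hsq s hs) (hsq t ht)
    (by positivity : 0 < √C₀ * δ ^ (η / 2)) hclose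
  simp_rw [kernel_eq_prod]
  linarith

theorem eLpNorm_two_le {d : ℕ} {f : (Fin d → ℝ≥0) → ℝ} (hf : MemLp f 2 (lebesgue d)) {R : ℝ}
    (h : ∫ u, f u ^ 2 ∂lebesgue d ≤ R) : eLpNorm f 2 (lebesgue d) ≤ ENNReal.ofReal √R := by
  rw [hf.eLpNorm_eq_integral_rpow_norm (by norm_num) (by norm_num), Real.sqrt_eq_rpow]
  norm_num
  refine ENNReal.ofReal_le_ofReal ?_
  exact Real.rpow_le_rpow (integral_nonneg fun _ => sq_nonneg _) h (by norm_num)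

end RLSheet

theorem mainTheorem5 {Ω : Type*} [MeasurableSpace Ω] (P : Measure Ω) [IsProbabilityMeasure P]
    (d : ℕ) (W : (Fin d → ℝ≥0) → Ω → ℝ) (hW : RLSheet.IsWienerProcess W P)
    (H : (Fin d → ℝ≥0) → Fin d → ℝ) (α β : Fin d → ℝ)
    (hα : ∀ i, 0 < α i) (hβ : ∀ i, β i < 1)
    (hH : ∀ i t, α i ≤ H t i ∧ H t i ≤ β i)
    (γ K : ℝ) (hγ : 0 < γ)
    (hHolder : ∀ t s : Fin d → ℝ≥0,
      RLSheet.euclNorm (fun i => H t i - H s i) ≤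
        K * RLSheet.euclNorm (fun i => (t i : ℝ) - (s i : ℝ)) ^ γ) :
    -- the integral defining `X(t)` exists for every `t ∈ ℝ₊^d`
    (∀ t, RLSheet.IsWienerIntegral W P (RLSheet.kernel H t) (RLSheet.sheet W P H t)) ∧
    -- there is a modification on `[0, 1]^d` all of whose paths are continuous
    ∃ Y : Set.Icc (0 : Fin d → ℝ≥0) 1 → Ω → ℝ,
      (∀ t, Measurable (Y t)) ∧
      (∀ ω, Continuous fun t => Y t ω) ∧
      ∀ t, Y t =ᵐ[P] RLSheet.sheet W P H t := by
  have hker : ∀ t, MemLp (RLSheet.kernel H t) 2 (RLSheet.lebesgue d) := fun t =>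
    RLSheet.memLp_kernel fun i => (hα i).trans_le (hH i t).1
  have hint : ∀ t, RLSheet.IsWienerIntegral W P (RLSheet.kernel H t) (RLSheet.sheet W P H t) :=
    fun t => hW.isWienerIntegral_wienerIntegral (hker t)
  refine ⟨hint, ?_⟩
  obtain ⟨a, ha, haα⟩ : ∃ a : ℝ, 0 < a ∧ ∀ i, a ≤ α i := by
    rcases isEmpty_or_nonempty (Fin d) with he | he
    · exact ⟨1, one_pos, fun i => he.elim i⟩
    · obtain ⟨i, hi⟩ := Finite.exists_min α
      exact ⟨α i, hα i, hi⟩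
  obtain ⟨C, η, hC, hη, hinc⟩ := RLSheet.exists_integral_kernel_sub_sq_le ha
    (fun i t => (haα i).trans (hH i t).1) (fun i t => (hH i t).2.trans (hβ i).le) hγ hHolder
  -- The criterion needs measurable variables, while the Wiener integrals are only almost everywhere
  -- measurable.
  set X : Set.Icc (0 : Fin d → ℝ≥0) 1 → Ω → ℝ := fun t => (hint t).2.1.1.mk _
  have hXae : ∀ t : Set.Icc (0 : Fin d → ℝ≥0) 1, RLSheet.sheet W P H t =ᵐ[P] X t := fun t => (hint t).2.1.1.ae_eq_mk
  -- Increments have `Lᵖ` norm of order `dist s t ^ (η / 2)`, so this `p` gives the moment exponent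
  -- `p * η / 2 = 2d + 1 > 2d`, as the grids of growth `2 ^ (n * d)` require.
  set p : ℝ≥0 := Real.toNNReal ((2 * d + 1) * 2 / η)
  have hp : (p : ℝ) = (2 * d + 1) * 2 / η := Real.coe_toNNReal _ (by positivity)
  have hp0 : (0 : ℝ) < p := by rw [hp]; positivity
  set G : ℝ≥0∞ := eLpNorm id p (gaussianReal 0 1)
  have hG : G ≠ ∞ := (memLp_id_gaussianReal p).eLpNorm_ne_top
  have hkol : IsKolmogorovProcess X P p (2 * d + 1) ((G.toNNReal * Real.toNNReal √C) ^ (p : ℝ)) := by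
    refine IsKolmogorovProcess.mk_of_secondCountableTopology
      (fun t => (hint t).2.1.1.stronglyMeasurable_mk.measurable) (fun s t => ?_) hp0 (by positivity)
    have h1 := ((hint s).sub hW (hint t)).eLpNorm_le hW p
    have h2 := RLSheet.eLpNorm_two_le ((hker s).sub (hker t)) (hinc s s.2 t t.2)
    have h3 : eLpNorm (X s - X t) p P ≤ G * ENNReal.ofReal √(C * dist s t ^ η) := by
      rw [← eLpNorm_congr_ae ((hXae s).sub (hXae t))]
      exact h1.trans (mul_le_mul_right h2 _)
    have hp0' : (p : ℝ≥0∞) ≠ 0 := by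
      have : p ≠ 0 := fun h => hp0.ne' (by rw [h]; rfl)
      exact_mod_cast this
    have h4 : ∫⁻ ω, edist (X s ω) (X t ω) ^ (p : ℝ) ∂P = eLpNorm (X s - X t) p P ^ (p : ℝ) := by
      rw [eLpNorm_eq_lintegral_rpow_enorm_toReal hp0' ENNReal.coe_ne_top, ENNReal.coe_toReal,
        one_div, ENNReal.rpow_inv_rpow hp0.ne']
      simp_rw [edist_eq_enorm_sub, Pi.sub_apply]
    have h5 : √(C * dist s t ^ η) = √C * dist s t ^ (η / 2) := by
      rw [Real.sqrt_mul hC, Real.sqrt_eq_rpow (dist s t ^ η), ← Real.rpow_mul dist_nonneg]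
      congr 2
      ring
    rw [h4]
    refine (ENNReal.rpow_le_rpow h3 hp0.le).trans_eq ?_
    rw [h5, ENNReal.ofReal_mul (Real.sqrt_nonneg _), ← mul_assoc,
      ENNReal.mul_rpow_of_nonneg _ _ hp0.le, ENNReal.coe_rpow_of_nonneg _ hp0.le,
      ENNReal.coe_mul, ENNReal.coe_toNNReal hG, edist_dist,
      ← ENNReal.ofReal_rpow_of_nonneg dist_nonneg (by positivity), ← ENNReal.rpow_mul, hp]
    congr 2
    field_simp
  obtain ⟨Y, hY, hYc, hYX⟩ := RLSheet.exists_continuous_modification hkol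
    (RLSheet.card_grid_le d) RLSheet.gridFloor_mem RLSheet.edist_gridFloor_le
    (by linarith)
  exact ⟨Y, hY, hYc, fun t => (hYX t).trans (hXae t).symm⟩
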